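/- Let $\Gamma\subseteq\mathrm{PSL}_2(\mathbb{R})$ be a cofinite Fuchsian group, i.e. a discrete subgroup such that the quotient $M=\Gamma\backslash\mathbb{H}$ of the upper half-plane has finite area with respect to $\mu_{\mathrm{hyp}}=dx\,dy/y^2$. For an integer $k\ge 1$ let $\mathcal{S}_{2k}^{\Gamma}$ be the complex vector space of cusp forms of weight $2k$ for $\Gamma$, that is, of holomorphic functions $f:\mathbb{H}\to\mathbb{C}$ with $f(\gamma z)=(cz+d)^{2k}f(z)$ for all $\gamma=\left(\begin{smallmatrix}a&b\\c&d\end{smallmatrix}\right)\in\Gamma$ that vanish at all cusps of $\Gamma$, with the Petersson inner product $\langle f_1,f_2\rangle=\int_M f_1(z)\overline{f_2(z)}\,y^{2k}\,\mu_{\mathrm{hyp}}(z)$. This space is finite-dimensional and has an orthonormal basis; for an orthonormal basis $f_1,\dots,f_d$ put $S_k^{\Gamma}(z)=\sum_{j=1}^{d}|f_j(z)|^2\,\mathrm{Im}(z)^{2k}$. Then there is a constant $C>0$, depending only on $\Gamma$, such that for every integer $k\ge 1$ and every orthonormal basis of $\mathcal{S}_{2k}^{\Gamma}$ $$\sup_{z\in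 M}S_k^{\Gamma}(z)\le C\,k^{3/2}.$$ -/

import Mathlib

open MeasureTheory UpperHalfPlane
open scoped MatrixGroups

noncomputable section

namespace FuchsianCusp

/-- The action of `PSL(2, ℝ)` on the upper half-plane by fractional linear transformations. -/
instance instMulActionPSL : MulAction PSL(2, ℝ) ℍ :=
  MulAction.compHom ℍ
    (Matrix.ProjectiveSpecialLinearGroup.toPGL (n := Fin 2) (R := ℝ))

/-- The class of `g ∈ SL(2, ℝ)` acts on `ℍ` by the Möbius transformation of `g`. -/
theorem coe_smul (g : SL(2, ℝ)) (z : ℍ) :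
    (((QuotientGroup.mk g : PSL(2, ℝ)) • z : ℍ) : ℂ)
      = ((g 0 0 : ℂ) * z + (g 0 1 : ℂ)) / ((g 1 0 : ℂ) * z + (g 1 1 : ℂ)) :=
  UpperHalfPlane.coe_specialLinearGroup_apply g z

/-- The full preimage in `SL(2, ℝ)` of a subgroup of `PSL(2, ℝ)`, as a subgroup of `GL(2, ℝ)`. -/
def matrixLift (Γ : Subgroup PSL(2, ℝ)) : Subgroup (GL (Fin 2) ℝ) :=
  (Γ.comap (QuotientGroup.mk' (Subgroup.center SL(2, ℝ)))).map Matrix.SpecialLinearGroup.toGL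

instance (Γ : Subgroup PSL(2, ℝ)) : (matrixLift Γ).HasDetOne :=
  inferInstanceAs (Subgroup.HasDetOne
    ((Γ.comap (QuotientGroup.mk' (Subgroup.center SL(2, ℝ)))).map Matrix.SpecialLinearGroup.toGL))

/-- A cofinite Fuchsian group: a discrete subgroup of `PSL(2, ℝ)` whose quotient `Γ \ ℍ` has finite
hyperbolic area, i.e. which has a fundamental domain of finite area for `dx dy / y ^ 2`
(the `volume` of `ℍ`). -/
structure IsCofiniteFuchsian (Γ : Subgroup PSL(2, ℝ)) : Prop where
  discrete : DiscreteTopology Γ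
  finite_area : ∃ F : Set ℍ, IsFundamentalDomain Γ F (volume : Measure ℍ) ∧ volume F < ⊤

/-- The space of cusp forms of weight `2k` for `Γ`: holomorphic `f : ℍ → ℂ` with
`f (γ z) = (c z + d) ^ (2k) f z` for `γ ∈ Γ`, vanishing at every cusp of `Γ`. -/
abbrev CuspForms (Γ : Subgroup PSL(2, ℝ)) (k : ℕ) : Type :=
  CuspForm (matrixLift Γ) (2 * (k : ℤ))

variable {Γ : Subgroup PSL(2, ℝ)} {k : ℕ}

/-- The Petersson inner product `∫_M f₁ * conj f₂ * y ^ (2k) dμ_hyp`, the integral over `M = Γ \ ℍ`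
being computed on a fundamental domain `F` of `Γ`. -/
def peterssonInner (F : Set ℍ) (f₁ f₂ : CuspForms Γ k) : ℂ :=
  ∫ z in F, f₁ z * (starRingEnd ℂ) (f₂ z) * ((z.im : ℂ) ^ (2 * k)) ∂(volume : Measure ℍ)

/-- Orthonormality with respect to the Petersson inner product. -/
def IsPeterssonOrthonormal {ι : Type} [DecidableEq ι] (F : Set ℍ) (f : ι → CuspForms Γ k) : Prop :=
  ∀ i j, peterssonInner F (f i) (f j) = if i = j then 1 else 0

/-- The sum `∑ j, |f_j z|² (Im z) ^ (2k)`; this is `S_k^Γ(z)` when `f` is an orthonormal basis. -/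
def sumSq {ι : Type} [Fintype ι] (f : ι → CuspForms Γ k) (z : ℍ) : ℝ :=
  ∑ j, ‖f j z‖ ^ 2 * z.im ^ (2 * k)

end FuchsianCusp

end

/-! By an extremal argument the sum over an orthonormal family at `z` is controlled by single forms.
It therefore suffices to bound `density k f z` by `C * k ^ (3/2)` times the integral of `density k
f` over `F`, uniformly in `f` and `z` (`exists_sup_bound`).

The local input is the sub-mean value inequality on a disc of hyperbolic radius about `k ^ (-1/2)`,
after twisting by an exponential that flattens `y ^ (2k)`. It costs a factor `k`, and unfolding the
disc into `F` costs the number `N` of elements of `Γ` moving `z` by at most `1 / √k`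
(`density_le_of_displacementBound`). On a compact set `N` is bounded. At height `y` in a cusp only
translations count, so `N` is at most of order `y / √k + 1` (`IsShortest.displacementBound`). Up to
height about `k` this is of order `√k`, which yields `k ^ (3/2)`. Above height `k` the maximum
principle in the variable `q` reduces to the horocycle at height `k` (`density_le_of_height`).

The geometry of `Γ` comes from a thick-thin decomposition. `tnorm g z` measures how far `g`, seen
from `z`, is from `±1`. Commutators of two nearby elements are nearer still (`tnorm_commutator_lt`),
so the shortest element at a point commutes with all short ones. Finite area makes the thick part
compact modulo `Γ` (`exists_compact_of_thick`). Sliding a thin point to the boundary of the thick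
part leaves finitely many candidates for its shortest element up to conjugacy, and the very short
ones are parabolic (`exists_compact_and_parabolics`).

Finite dimension comes from the same estimate: integrating the sum over `F` bounds the size of any
orthonormal family. -/

namespace FuchsianCusp

noncomputable section

open scoped Manifold

set_option linter.unusedSimpArgs false

/-! ### Distance of a matrix from `±1` as seen from a point; commutator contraction and packing. -/

section

/-- The squared Hilbert–Schmidt norm of the traceless part of a conjugate of `g` taking `z` to the
base point. -/
def tnorm (g : SL(2, ℝ)) (z : ℍ) : ℝ :=
  2 * Real.cosh (dist z (g • z)) - (g 0 0 + g 1 1) ^ 2 / 2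

theorem sl_det (g : SL(2, ℝ)) : g 0 0 * g 1 1 - g 0 1 * g 1 0 = 1 := by
  have := g.det_coe
  rwa [Matrix.det_fin_two] at this

theorem sl_ext {g h : SL(2, ℝ)} (h00 : g 0 0 = h 0 0) (h01 : g 0 1 = h 0 1)
    (h10 : g 1 0 = h 1 0) (h11 : g 1 1 = h 1 1) : g = h := by
  ext i j
  fin_cases i <;> fin_cases j <;> assumption

theorem sl_mul_apply (g h : SL(2, ℝ)) (i j : Fin 2) :
    (g * h) i j = g i 0 * h 0 j + g i 1 * h 1 j := by
  simp [Matrix.mul_apply, Fin.sum_univ_two]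

theorem sl_inv_entries (g : SL(2, ℝ)) : (g⁻¹ : SL(2, ℝ)) 0 0 = g 1 1 ∧
    (g⁻¹ : SL(2, ℝ)) 0 1 = -g 0 1 ∧ (g⁻¹ : SL(2, ℝ)) 1 0 = -g 1 0 ∧
    (g⁻¹ : SL(2, ℝ)) 1 1 = g 0 0 := by
  simp [Matrix.SpecialLinearGroup.SL2_inv_expl]

theorem im_sl_smul (g : SL(2, ℝ)) (z : ℍ) :
    (g • z).im = z.im / Complex.normSq ((g 1 0 : ℂ) * z + (g 1 1 : ℂ)) := by
  rw [MulAction.compHom_smul_def, im_smul_eq_div_normSq]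
  simp [denom]

theorem sl_denom_ne_zero (g : SL(2, ℝ)) (z : ℍ) : (g 1 0 : ℂ) * z + (g 1 1 : ℂ) ≠ 0 :=
  UpperHalfPlane.denom_ne_zero (g : GL (Fin 2) ℝ) z

theorem cosh_dist_smul (g : SL(2, ℝ)) (z : ℍ) :
    Real.cosh (dist z (g • z)) = 1 +
      ((g 1 0 * (z.re ^ 2 - z.im ^ 2) + (g 1 1 - g 0 0) * z.re - g 0 1) ^ 2 +
        (z.im * (2 * g 1 0 * z.re + (g 1 1 - g 0 0))) ^ 2) / (2 * z.im ^ 2) := by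
  have hy := z.im_pos
  have hd := sl_denom_ne_zero g z
  have hn : Complex.normSq ((g 1 0 : ℂ) * z + (g 1 1 : ℂ)) ≠ 0 := by simpa using hd
  have hn' : 0 < Complex.normSq ((g 1 0 : ℂ) * z + (g 1 1 : ℂ)) :=
    Complex.normSq_pos.mpr hd
  rw [UpperHalfPlane.cosh_dist, im_sl_smul, Complex.dist_eq]
  have e : (z : ℂ) - ((g • z : ℍ) : ℂ) =
      ((g 1 0 : ℂ) * z ^ 2 + ((g 1 1 : ℂ) - g 0 0) * z - g 0 1) /
        ((g 1 0 : ℂ) * z + (g 1 1 : ℂ)) := by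
    have := UpperHalfPlane.coe_specialLinearGroup_apply g z
    rw [this]
    simp only [Algebra.algebraMap_self, RingHom.id_apply]
    rw [eq_div_iff hd, sub_mul, div_mul_cancel₀ _ hd]
    ring
  rw [e, ← Complex.normSq_eq_norm_sq, Complex.normSq_div]
  have e2 : Complex.normSq ((g 1 0 : ℂ) * z ^ 2 + ((g 1 1 : ℂ) - g 0 0) * z - g 0 1) =
      (g 1 0 * (z.re ^ 2 - z.im ^ 2) + (g 1 1 - g 0 0) * z.re - g 0 1) ^ 2 +
        (z.im * (2 * g 1 0 * z.re + (g 1 1 - g 0 0))) ^ 2 := by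
    rw [Complex.normSq_apply]
    simp [pow_two]
    ring
  rw [e2]
  field_simp

theorem tnorm_eq (g : SL(2, ℝ)) (z : ℍ) : tnorm g z =
    ((g 1 0 * (z.re ^ 2 - z.im ^ 2) + (g 1 1 - g 0 0) * z.re - g 0 1) ^ 2 +
        (z.im * (2 * g 1 0 * z.re + (g 1 1 - g 0 0))) ^ 2) / z.im ^ 2
      - (g 1 1 - g 0 0) ^ 2 / 2 - 2 * (g 0 1 * g 1 0) := by
  have hy := z.im_pos
  rw [tnorm, cosh_dist_smul]
  have := sl_det g
  have e : g 0 1 * g 1 0 = g 0 0 * g 1 1 - 1 := by linarith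
  rw [e]
  field_simp
  ring

theorem tnorm_I (g : SL(2, ℝ)) :
    tnorm g I = (g 0 0 - g 1 1) ^ 2 / 2 + g 0 1 ^ 2 + g 1 0 ^ 2 := by
  rw [tnorm_eq]
  simp
  ring

theorem trace_conj (h g : SL(2, ℝ)) :
    (h * g * h⁻¹) 0 0 + (h * g * h⁻¹) 1 1 = g 0 0 + g 1 1 := by
  obtain ⟨h1, h2, h3, h4⟩ := sl_inv_entries h
  have := sl_det h
  simp only [sl_mul_apply, h1, h2, h3, h4]
  linear_combination (g 0 0 + g 1 1) * this

/-- Trace and displacement are both conjugation invariant. Since the action is transitive, every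
estimate on `tnorm` can be checked at `I`, where it is a quadratic form in the entries. -/
theorem tnorm_conj (h g : SL(2, ℝ)) (z : ℍ) : tnorm (h * g * h⁻¹) (h • z) = tnorm g z := by
  rw [tnorm, tnorm, trace_conj]
  congr 3
  rw [mul_smul, inv_smul_smul, mul_smul, dist_smul]

theorem tnorm_smul (h g : SL(2, ℝ)) (z : ℍ) : tnorm g (h • z) = tnorm (h⁻¹ * g * h) z := by
  rw [← tnorm_conj h (h⁻¹ * g * h) z]
  congr 1
  group

theorem exists_smul_I (z : ℍ) : ∃ h : SL(2, ℝ), h • I = z := ⟨_, toSL2R_smul_I z⟩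

theorem tnorm_nonneg (g : SL(2, ℝ)) (z : ℍ) : 0 ≤ tnorm g z := by
  obtain ⟨h, rfl⟩ := exists_smul_I z
  rw [tnorm_smul, tnorm_I]
  positivity

theorem eq_one_or_neg_one_of_scalar {g : SL(2, ℝ)} (h0 : g 0 0 = g 1 1) (h1 : g 0 1 = 0)
    (h2 : g 1 0 = 0) : g = 1 ∨ g = -1 := by
  have := sl_det g
  rw [h1, ← h0] at this
  have h3 : (g 0 0 - 1) * (g 0 0 + 1) = 0 := by linarith
  rcases mul_eq_zero.mp h3 with h | h
  · left
    apply sl_ext <;> simp [h1, h2] <;> linarith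
  · right
    apply sl_ext <;> simp [h1, h2] <;> linarith

theorem tnorm_eq_zero_iff {g : SL(2, ℝ)} {z : ℍ} : tnorm g z = 0 ↔ g = 1 ∨ g = -1 := by
  constructor
  · obtain ⟨h, rfl⟩ := exists_smul_I z
    rw [tnorm_smul, tnorm_I]
    intro h0
    set m := h⁻¹ * g * h with hm
    have h1 : m 0 1 = 0 := by nlinarith [sq_nonneg (m 0 1), sq_nonneg (m 1 0), sq_nonneg (m 0 0 - m 1 1)]
    have h2 : m 1 0 = 0 := by nlinarith [sq_nonneg (m 0 1), sq_nonneg (m 1 0), sq_nonneg (m 0 0 - m 1 1)]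
    have h3 : m 0 0 - m 1 1 = 0 := by nlinarith [sq_nonneg (m 0 1), sq_nonneg (m 1 0), sq_nonneg (m 0 0 - m 1 1)]
    have hg : g = h * m * h⁻¹ := by rw [hm]; group
    rcases eq_one_or_neg_one_of_scalar (by linarith) h1 h2 with h | h
    · left; rw [hg, h]; group
    · right; rw [hg, h]; simp
  · rintro (rfl | rfl) <;> rw [tnorm_eq] <;> simp

theorem tnorm_pos {g : SL(2, ℝ)} (h1 : g ≠ 1) (h2 : g ≠ -1) (z : ℍ) : 0 < tnorm g z := by
  refine lt_of_le_of_ne (tnorm_nonneg g z) fun h ↦ ?_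
  rcases tnorm_eq_zero_iff.mp h.symm with h | h <;> contradiction

theorem continuous_tnorm (g : SL(2, ℝ)) : Continuous (tnorm g) := by
  unfold tnorm
  have : Continuous fun z : ℍ ↦ g • z := continuous_const_smul g
  fun_prop

/-- The sum of the squares of the entries. -/
def hs (M : Matrix (Fin 2) (Fin 2) ℝ) : ℝ := M 0 0 ^ 2 + M 0 1 ^ 2 + M 1 0 ^ 2 + M 1 1 ^ 2

theorem hs_nonneg (M : Matrix (Fin 2) (Fin 2) ℝ) : 0 ≤ hs M := by unfold hs; positivity

theorem hs_mul_le (M N : Matrix (Fin 2) (Fin 2) ℝ) : hs (M * N) ≤ hs M * hs N := by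
  simp only [hs, Matrix.mul_apply, Fin.sum_univ_two]
  nlinarith [sq_nonneg (M 0 0 * N 1 0 - M 0 1 * N 0 0), sq_nonneg (M 0 0 * N 1 1 - M 0 1 * N 0 1),
    sq_nonneg (M 1 0 * N 1 0 - M 1 1 * N 0 0), sq_nonneg (M 1 0 * N 1 1 - M 1 1 * N 0 1)]

theorem hs_inv (g : SL(2, ℝ)) : hs (g⁻¹ : SL(2, ℝ)) = hs g := by
  obtain ⟨h1, h2, h3, h4⟩ := sl_inv_entries g
  simp only [hs, h1, h2, h3, h4]
  ring

theorem hs_eq_cosh (g : SL(2, ℝ)) : hs g = 2 * Real.cosh (dist I (g • I)) := by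
  rw [cosh_dist_smul]
  have := sl_det g
  simp [hs]
  linear_combination 2 * this

/-- Splitting off the scalar part gives `hs g = tnorm g I + (tr g)² / 2`, and the determinant
condition bounds `(tr g)² / 2` by `2 + tnorm g I`. -/
theorem hs_le (g : SL(2, ℝ)) : hs g ≤ 2 + 2 * tnorm g I := by
  rw [tnorm_I, hs]
  nlinarith [sl_det g, sq_nonneg (g 0 1 + g 1 0), sq_nonneg (g 0 1 - g 1 0),
    sq_nonneg (g 0 0 - g 1 1)]

theorem cosh_dist_le (g : SL(2, ℝ)) (z : ℍ) :
    Real.cosh (dist z (g • z)) ≤ 1 + tnorm g z := by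
  obtain ⟨h, rfl⟩ := exists_smul_I z
  have h1 := hs_le (h⁻¹ * g * h)
  rw [hs_eq_cosh] at h1
  rw [tnorm_smul]
  have : dist (h • I) (g • h • I) = dist I ((h⁻¹ * g * h) • I) := by
    rw [← dist_smul h I, ← mul_smul, ← mul_smul]
    congr 2
    group
  rw [this]
  linarith

theorem tnorm_le_hs_sub_one (g : SL(2, ℝ)) : tnorm g I ≤ hs ((g : Matrix (Fin 2) (Fin 2) ℝ) - 1) := by
  rw [tnorm_I]
  simp [hs]
  nlinarith [sq_nonneg (g 0 0 + g 1 1 - 2)]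

theorem tnorm_inv_mul_le (g h : SL(2, ℝ)) :
    tnorm (g⁻¹ * h) I ≤ hs g * hs ((h : Matrix (Fin 2) (Fin 2) ℝ) - g) := by
  refine (tnorm_le_hs_sub_one _).trans ?_
  have : ((g⁻¹ * h : SL(2, ℝ)) : Matrix (Fin 2) (Fin 2) ℝ) - 1 =
      ((g⁻¹ : SL(2, ℝ)) : Matrix (Fin 2) (Fin 2) ℝ) * ((h : Matrix (Fin 2) (Fin 2) ℝ) - g) := by
    rw [mul_sub, ← Matrix.SpecialLinearGroup.coe_mul, ← Matrix.SpecialLinearGroup.coe_mul]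
    simp
  rw [this, ← hs_inv g]
  exact hs_mul_le _ _

/-- Scalars are central, so `g * h - h * g` depends only on the traceless parts and is bilinear in
them. -/
theorem hs_commutator_le (g h : SL(2, ℝ)) :
    hs ((g * h : Matrix (Fin 2) (Fin 2) ℝ) - h * g) ≤ 4 * tnorm g I * tnorm h I := by
  rw [tnorm_I, tnorm_I]
  simp only [hs, Matrix.sub_apply, Matrix.mul_apply, Fin.sum_univ_two]
  generalize hp : (g 0 0 - g 1 1) = p
  generalize hq : (h 0 0 - h 1 1) = q
  have e1 : g 0 0 = g 1 1 + p := by linarith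
  have e2 : h 0 0 = h 1 1 + q := by linarith
  rw [e1, e2]
  generalize g 0 1 = b, g 1 0 = c, g 1 1 = d, h 0 1 = e, h 1 0 = f, h 1 1 = k
  have h1 := sq_nonneg (b * e + c * f + p * q / 4)
  have h2 : 0 ≤ (b ^ 2 + c ^ 2) * (e ^ 2 + f ^ 2) := by positivity
  have h3 : 0 ≤ p ^ 2 * q ^ 2 := by positivity
  have h4 : 0 ≤ p ^ 2 * (e ^ 2 + f ^ 2) := by positivity
  have h5 : 0 ≤ q ^ 2 * (b ^ 2 + c ^ 2) := by positivity
  have h6 := sq_nonneg (b * f + c * e)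
  nlinarith [sq_nonneg (b * e + c * f + p * q / 2), sq_nonneg (b * e + c * f), sq_nonneg (b * e - c * f),sq_nonneg (b * f - c * e), sq_nonneg (p * e + q * b), sq_nonneg (p * f + q * c)]

theorem tnorm_commutator_I_le (g h : SL(2, ℝ)) : tnorm (g * h * g⁻¹ * h⁻¹) I ≤
    4 * tnorm g I * tnorm h I * ((2 + 2 * tnorm g I) * (2 + 2 * tnorm h I)) := by
  refine (tnorm_le_hs_sub_one _).trans ?_
  have e : ((g * h * g⁻¹ * h⁻¹ : SL(2, ℝ)) : Matrix (Fin 2) (Fin 2) ℝ) - 1 =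
      ((g * h : Matrix (Fin 2) (Fin 2) ℝ) - h * g) * ((g⁻¹ * h⁻¹ : SL(2, ℝ))) := by
    rw [sub_mul, ← Matrix.SpecialLinearGroup.coe_mul, ← Matrix.SpecialLinearGroup.coe_mul,
      ← Matrix.SpecialLinearGroup.coe_mul, ← Matrix.SpecialLinearGroup.coe_mul]
    rw [show h * g * (g⁻¹ * h⁻¹) = 1 by group, ← mul_assoc, Matrix.SpecialLinearGroup.coe_one]
  rw [e]
  refine (hs_mul_le _ _).trans ?_
  refine mul_le_mul (hs_commutator_le g h) ?_ (hs_nonneg _) ?_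
  · rw [Matrix.SpecialLinearGroup.coe_mul]
    refine (hs_mul_le _ _).trans ?_
    rw [hs_inv, hs_inv]
    have := tnorm_nonneg g I
    exact mul_le_mul (hs_le g) (hs_le h) (hs_nonneg _) (by linarith)
  · have := tnorm_nonneg g I
    have := tnorm_nonneg h I
    positivity

theorem tnorm_commutator_le (g h : SL(2, ℝ)) (z : ℍ) : tnorm (g * h * g⁻¹ * h⁻¹) z ≤
    4 * tnorm g z * tnorm h z * ((2 + 2 * tnorm g z) * (2 + 2 * tnorm h z)) := by
  obtain ⟨k, rfl⟩ := exists_smul_I z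
  simp only [tnorm_smul]
  have := tnorm_commutator_I_le (k⁻¹ * g * k) (k⁻¹ * h * k)
  convert this using 2
  group

/-- The contraction behind the Zassenhaus–Margulis lemma. At threshold `1/64` the factor in
`tnorm_commutator_le` is at most `4 * (1/64) * 9 < 1`. -/
theorem tnorm_commutator_lt {g h : SL(2, ℝ)} {z : ℍ} (hg : 0 < tnorm g z)
    (hg' : tnorm g z ≤ 1 / 64) (hh : tnorm h z ≤ 1 / 64) :
    tnorm (g * h * g⁻¹ * h⁻¹) z < tnorm g z := by
  refine (tnorm_commutator_le g h z).trans_lt ?_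
  have h0 := tnorm_nonneg h z
  have h1 : (2 + 2 * tnorm g z) * (2 + 2 * tnorm h z) ≤ 3 * 3 := by
    apply mul_le_mul <;> linarith
  have h2 : 4 * tnorm g z * tnorm h z ≤ 4 * tnorm g z * (1 / 64) := by
    apply mul_le_mul_of_nonneg_left hh; positivity
  calc _ ≤ 4 * tnorm g z * (1 / 64) * (3 * 3) := by
        apply mul_le_mul h2 h1 _ (by positivity)
        positivity
    _ < _ := by linarith

theorem trace_ne_zero_of_tnorm_lt {g : SL(2, ℝ)} {z : ℍ} (h : tnorm g z < 2) :
    g 0 0 + g 1 1 ≠ 0 := by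
  intro h0
  have := Real.one_le_cosh (dist z (g • z))
  rw [tnorm, h0] at h
  linarith

/-- Elements close to the identity that commute up to sign commute. -/
theorem commute_of_commutator {g h : SL(2, ℝ)} {z : ℍ} (hg : tnorm g z < 2)
    (H : g * h * g⁻¹ * h⁻¹ = 1 ∨ g * h * g⁻¹ * h⁻¹ = -1) : g * h = h * g := by
  rcases H with H | H
  · have : g * h = (g * h * g⁻¹ * h⁻¹) * (h * g) := by group
    rw [this, H, one_mul]
  · exfalso
    have h1 : g * h = (g * h * g⁻¹ * h⁻¹) * (h * g) := by group
    rw [H] at h1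
    -- If `g` were conjugate to `-g`, its trace would vanish, which is impossible near `±1`.
    have h2 : h⁻¹ * g * h⁻¹⁻¹ = -g := by
      rw [inv_inv, mul_assoc, h1]
      simp
    have h3 := trace_conj h⁻¹ g
    rw [h2] at h3
    apply trace_ne_zero_of_tnorm_lt hg
    simp at h3
    linarith

/-- The traceless parts of commuting elements are proportional. -/
theorem exists_tnorm_eq_of_commute {g h : SL(2, ℝ)} (h1 : g ≠ 1) (h2 : g ≠ -1)
    (hc : g * h = h * g) : ∃ β : ℝ, h 0 1 = β * g 0 1 ∧ h 1 0 = β * g 1 0 ∧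
      h 0 0 - h 1 1 = β * (g 0 0 - g 1 1) ∧ ∀ z, tnorm h z = β ^ 2 * tnorm g z := by
  have c : ∀ i j, (g * h) i j = (h * g) i j := fun i j ↦ by rw [hc]
  have c00 := c 0 0
  have c01 := c 0 1
  have c10 := c 1 0
  simp only [sl_mul_apply] at c00 c01 c10
  suffices ∃ β : ℝ, h 0 1 = β * g 0 1 ∧ h 1 0 = β * g 1 0 ∧
      h 0 0 - h 1 1 = β * (g 0 0 - g 1 1) by
    obtain ⟨β, e1, e2, e3⟩ := this
    refine ⟨β, e1, e2, e3, fun z ↦ ?_⟩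
    have e4 : h 1 1 - h 0 0 = β * (g 1 1 - g 0 0) := by linarith
    rw [tnorm_eq, tnorm_eq, e4, e1, e2]
    ring
  by_cases hb : g 0 1 = 0
  · by_cases hcc : g 1 0 = 0
    · have hd : g 0 0 - g 1 1 ≠ 0 := by
        intro hd
        rcases eq_one_or_neg_one_of_scalar (by linarith) hb hcc with h | h <;> contradiction
      refine ⟨(h 0 0 - h 1 1) / (g 0 0 - g 1 1), ?_, ?_, ?_⟩
      · rw [hb] at c01 ⊢
        have : (g 0 0 - g 1 1) * h 0 1 = 0 := by linarith
        simpa [hd] using this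
      · rw [hcc] at c10 ⊢
        have : (g 0 0 - g 1 1) * h 1 0 = 0 := by linarith
        simpa [hd] using this
      · field_simp
    · refine ⟨h 1 0 / g 1 0, ?_, ?_, ?_⟩ <;> field_simp <;> linarith
  · refine ⟨h 0 1 / g 0 1, ?_, ?_, ?_⟩ <;> field_simp <;> linarith

/-- The function `tnorm g` is unbounded unless `g` is trivial. -/
theorem exists_le_tnorm {g : SL(2, ℝ)} (h1 : g ≠ 1) (h2 : g ≠ -1) (B : ℝ) :
    ∃ z : ℍ, B ≤ tnorm g z := by
  -- The point `x` is a boundary point not fixed by `g`. Approaching it vertically, `tnorm g` grows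
  -- at least like `q ^ 2 / y ^ 2`.
  obtain ⟨x, hx⟩ : ∃ x : ℝ, g 1 0 * x ^ 2 + (g 1 1 - g 0 0) * x - g 0 1 ≠ 0 := by
    by_contra! H
    have e0 := H 0
    have e1 := H 1
    have e2 := H (-1)
    rcases eq_one_or_neg_one_of_scalar (g := g) (by linarith) (by linarith) (by linarith)
      with h | h <;> contradiction
  set q := g 1 0 * x ^ 2 + (g 1 1 - g 0 0) * x - g 0 1 with hq
  set K := (g 1 1 - g 0 0) ^ 2 / 2 + 2 * (g 0 1 * g 1 0) with hK
  have hlim : Filter.Tendsto (fun y : ℝ ↦ (q - g 1 0 * y ^ 2) ^ 2 - (B + K) * y ^ 2)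
      (nhdsWithin 0 (Set.Ioi 0)) (nhds (q ^ 2)) := by
    have : Continuous fun y : ℝ ↦ (q - g 1 0 * y ^ 2) ^ 2 - (B + K) * y ^ 2 := by fun_prop
    have := (this.tendsto 0).mono_left (nhdsWithin_le_nhds (s := Set.Ioi 0))
    simpa using this
  have hpos : 0 < q ^ 2 := by positivity
  obtain ⟨y, hy1, hy⟩ := ((hlim.eventually_const_lt hpos).and self_mem_nhdsWithin).exists
  have hy : 0 < y := hy
  refine ⟨⟨⟨x, y⟩, hy⟩, ?_⟩
  rw [tnorm_eq]
  have e1 : (⟨⟨x, y⟩, hy⟩ : ℍ).re = x := rfl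
  have e2 : (⟨⟨x, y⟩, hy⟩ : ℍ).im = y := rfl
  rw [e1, e2]
  have : B + K ≤ ((g 1 0 * (x ^ 2 - y ^ 2) + (g 1 1 - g 0 0) * x - g 0 1) ^ 2 +
      (y * (2 * g 1 0 * x + (g 1 1 - g 0 0))) ^ 2) / y ^ 2 := by
    rw [le_div_iff₀ (by positivity)]
    have : g 1 0 * (x ^ 2 - y ^ 2) + (g 1 1 - g 0 0) * x - g 0 1 = q - g 1 0 * y ^ 2 := by
      rw [hq]; ring
    rw [this]
    nlinarith [sq_nonneg (y * (2 * g 1 0 * x + (g 1 1 - g 0 0)))]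
  linarith

/-- Lower bound for `tnorm` in terms of the trace. -/
theorem abs_trace_le_tnorm (g : SL(2, ℝ)) (z : ℍ) :
    |2 - (g 0 0 + g 1 1) ^ 2 / 2| ≤ tnorm g z := by
  obtain ⟨k, rfl⟩ := exists_smul_I z
  have ht := trace_conj k⁻¹ g
  rw [inv_inv] at ht
  rw [tnorm_smul, ← ht]
  generalize k⁻¹ * g * k = m
  rw [tnorm_I, abs_le]
  have := sl_det m
  constructor <;> nlinarith [sq_nonneg (m 0 1 + m 1 0), sq_nonneg (m 0 1 - m 1 0),
    sq_nonneg (m 0 0 - m 1 1)]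

/-- Packing: a uniformly separated set of elements moving a point a bounded distance has bounded
cardinality. -/
theorem exists_card_le_of_separated {c : ℝ} (hc : 0 < c) (R : ℝ) :
    ∃ M : ℕ, ∀ (z : ℍ) (s : Finset SL(2, ℝ)), (∀ g ∈ s, dist z (g • z) ≤ R) →
      (∀ g ∈ s, ∀ h ∈ s, g ≠ h → c ≤ tnorm (g⁻¹ * h) z) → s.card ≤ M := by
  set B := 2 * Real.cosh R with hB
  have hBpos : 0 < B := by positivity
  -- Two matrices in one `ε`-ball differ by at most `2 * ε` in each of four entries, so `16 * ε ^ 2`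
  -- bounds `hs` of the difference. Separation then allows one element per ball.
  obtain ⟨ε, hε, hεc⟩ : ∃ ε : ℝ, 0 < ε ∧ B * (16 * ε ^ 2) < c := by
    have : Filter.Tendsto (fun ε : ℝ ↦ B * (16 * ε ^ 2)) (nhdsWithin 0 (Set.Ioi 0)) (nhds 0) := by
      have h : Continuous fun ε : ℝ ↦ B * (16 * ε ^ 2) := by fun_prop
      simpa using (h.tendsto 0).mono_left (nhdsWithin_le_nhds (s := Set.Ioi 0))
    obtain ⟨ε, h1, h2⟩ := ((this.eventually_lt_const hc).and self_mem_nhdsWithin).exists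
    exact ⟨ε, h2, h1⟩
  have hcomp : TotallyBounded (Metric.closedBall (0 : Fin 2 → Fin 2 → ℝ) B) :=
    (isCompact_closedBall _ _).totallyBounded
  obtain ⟨t, ht, hcov⟩ := Metric.totallyBounded_iff.mp hcomp ε hε
  refine ⟨ht.toFinset.card, fun z s hsR hsep ↦ ?_⟩
  obtain ⟨k, rfl⟩ := exists_smul_I z
  have hsm : ∀ g ∈ s, hs (k⁻¹ * g * k : SL(2, ℝ)) ≤ B := by
    intro g hg
    have h1 := hsR g hg
    have : dist (k • I) (g • k • I) = dist I ((k⁻¹ * g * k) • I) := by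
      rw [← dist_smul k I, ← mul_smul, ← mul_smul]
      congr 2
      group
    rw [this] at h1
    rw [hs_eq_cosh, hB]
    have := Real.cosh_le_cosh.mpr (abs_le_abs_of_nonneg dist_nonneg h1)
    linarith
  have hB2 : 2 ≤ B := by have := Real.one_le_cosh R; linarith
  have hex : ∀ g ∈ s, ∃ p ∈ t, dist (fun i j ↦ (k⁻¹ * g * k : SL(2, ℝ)) i j) p < ε := by
    intro g hg
    have : (fun i j ↦ (k⁻¹ * g * k : SL(2, ℝ)) i j) ∈
        Metric.closedBall (0 : Fin 2 → Fin 2 → ℝ) B := by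
      have h1 := hsm g hg
      rw [mem_closedBall_zero_iff, pi_norm_le_iff_of_nonneg hBpos.le]
      intro i
      rw [pi_norm_le_iff_of_nonneg hBpos.le]
      intro j
      rw [Real.norm_eq_abs]
      apply abs_le_of_sq_le_sq _ hBpos.le
      have h2 : (k⁻¹ * g * k : SL(2, ℝ)) i j ^ 2 ≤ hs (k⁻¹ * g * k : SL(2, ℝ)) := by
        unfold hs
        generalize (k⁻¹ * g * k : SL(2, ℝ)) = m
        fin_cases i <;> fin_cases j <;> simp only [Fin.zero_eta, Fin.mk_one] <;>
          linarith [sq_nonneg (m 0 0), sq_nonneg (m 0 1), sq_nonneg (m 1 0), sq_nonneg (m 1 1)]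
      nlinarith
    simpa using hcov this
  choose! p hpt hpd using hex
  refine Finset.card_le_card_of_injOn p (fun g hg ↦ by simpa using hpt g hg) ?_
  intro g hg h hh hgh
  by_contra hne
  have h1 := hsep g hg h hh hne
  rw [tnorm_smul, show k⁻¹ * (g⁻¹ * h) * k = (k⁻¹ * g * k)⁻¹ * (k⁻¹ * h * k) by group] at h1
  have h2 := h1.trans (tnorm_inv_mul_le _ _)
  have hd : dist (fun i j ↦ (k⁻¹ * h * k : SL(2, ℝ)) i j) (fun i j ↦ (k⁻¹ * g * k : SL(2, ℝ)) i j)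
      < 2 * ε := by
    have := dist_triangle_right (fun i j ↦ (k⁻¹ * h * k : SL(2, ℝ)) i j)
      (fun i j ↦ (k⁻¹ * g * k : SL(2, ℝ)) i j) (p g)
    have h3 := hpd g hg
    have h4 := hpd h hh
    rw [← hgh] at h4
    linarith
  have hent : ∀ i j, ((k⁻¹ * h * k : SL(2, ℝ)) i j - (k⁻¹ * g * k : SL(2, ℝ)) i j) ^ 2
      ≤ (2 * ε) ^ 2 := by
    intro i j
    have h5 := (dist_le_pi_dist _ _ j).trans ((dist_le_pi_dist _ _ i).trans hd.le)
    rw [Real.dist_eq] at h5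
    exact sq_le_sq' (abs_le.mp h5).1 (abs_le.mp h5).2
  have h3 : hs (((k⁻¹ * h * k : SL(2, ℝ)) : Matrix (Fin 2) (Fin 2) ℝ) -
      (k⁻¹ * g * k : SL(2, ℝ))) ≤ 16 * ε ^ 2 := by
    simp only [hs, Matrix.sub_apply]
    linarith [hent 0 0, hent 0 1, hent 1 0, hent 1 1]
  have h4 := mul_le_mul (hsm g hg) h3 (hs_nonneg _) hBpos.le
  linarith

end

/-! ### Shortest elements, the thick-thin decomposition and cusp neighbourhoods. -/

section

/-- `g` is a nontrivial element of `G` whose conjugate at `z` is closest to the identity. -/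
structure IsShortest (G : Subgroup SL(2, ℝ)) (g : SL(2, ℝ)) (z : ℍ) : Prop where
  mem : g ∈ G
  ne_one : g ≠ 1
  ne_neg_one : g ≠ -1
  le : ∀ h ∈ G, h ≠ 1 → h ≠ -1 → tnorm g z ≤ tnorm h z

variable {G : Subgroup SL(2, ℝ)} {g h : SL(2, ℝ)} {z w : ℍ}

theorem finite_smul_inter [DiscreteTopology G] {K L : Set ℍ} (hK : IsCompact K)
    (hL : IsCompact L) : {g | g ∈ G ∧ ∃ z ∈ K, g • z ∈ L}.Finite := by
  have h := ProperlyDiscontinuousSMul.finite_disjoint_inter_image (Γ := G) hK hL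
  refine (h.image ((↑) : G → SL(2, ℝ))).subset ?_
  rintro g ⟨hg, z, hz, hgz⟩
  exact ⟨⟨g, hg⟩, ⟨_, ⟨z, hz, rfl⟩, hgz⟩, rfl⟩

theorem finite_tnorm_le [DiscreteTopology G] {K : Set ℍ} (hK : IsCompact K) (B : ℝ) :
    {g | g ∈ G ∧ ∃ z ∈ K, tnorm g z ≤ B}.Finite := by
  obtain ⟨R, hR⟩ : ∃ R : ℝ, ∀ x, 0 ≤ x → Real.cosh x ≤ 1 + B → x ≤ R := by
    refine ⟨2 * (1 + B), fun x hx h ↦ ?_⟩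
    rw [Real.cosh_eq] at h
    have h1 := Real.add_one_le_exp x
    have h2 := Real.exp_pos (-x)
    linarith
  have hL : IsCompact (Metric.cthickening R K) := hK.cthickening
  refine (finite_smul_inter (G := G) hK hL).subset ?_
  rintro g ⟨hg, z, hz, hgz⟩
  refine ⟨hg, z, hz, ?_⟩
  refine Metric.mem_cthickening_of_dist_le _ z _ _ hz ?_
  rw [dist_comm]
  exact hR _ dist_nonneg ((cosh_dist_le g z).trans (by linarith))

theorem exists_isShortest [DiscreteTopology G] (hh : h ∈ G) (h1 : h ≠ 1) (h2 : h ≠ -1) (z : ℍ) :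
    ∃ g, IsShortest G g z := by
  have hfin := (finite_tnorm_le (G := G) (isCompact_singleton (x := z)) (tnorm h z)).inter_of_left
    {g | g ≠ 1 ∧ g ≠ -1}
  obtain ⟨g, ⟨⟨hgG, z', hz', hgz⟩, hg1, hg2⟩, hmin⟩ := Set.exists_min_image _ (fun g ↦ tnorm g z) hfin
    ⟨h, ⟨hh, z, rfl, le_rfl⟩, h1, h2⟩
  obtain rfl : z' = z := hz'
  refine ⟨g, hgG, hg1, hg2, fun k hk k1 k2 ↦ ?_⟩
  rcases le_total (tnorm k z') (tnorm h z') with hle | hle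
  · exact hmin k ⟨⟨hk, z', rfl, hle⟩, k1, k2⟩
  · exact hgz.trans hle

/-- A shortest element commutes with every element close to the identity. -/
theorem IsShortest.commute (hg : IsShortest G g z) (hgz : tnorm g z ≤ 1 / 64) (hh : h ∈ G)
    (hhz : tnorm h z ≤ 1 / 64) : g * h = h * g := by
  refine commute_of_commutator (z := z) (by linarith) ?_
  by_contra! H
  have h1 := hg.le (g * h * g⁻¹ * h⁻¹)
    (G.mul_mem (G.mul_mem (G.mul_mem hg.mem hh) (G.inv_mem hg.mem)) (G.inv_mem hh)) H.1 H.2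
  exact absurd (tnorm_commutator_lt (tnorm_pos hg.ne_one hg.ne_neg_one z) hgz hhz) (not_lt.mpr h1)

/-- The shortest element `k` at `w` commutes with `g`, so `tnorm g` and `tnorm k` have a ratio
independent of the point. Minimality of `g` at `z` fixes that ratio to be at most `1`, hence `g` is
also minimal at `w`. -/
theorem IsShortest.of_tnorm_le [DiscreteTopology G] (hg : IsShortest G g z)
    (hw : tnorm g w ≤ 1 / 64) : IsShortest G g w := by
  obtain ⟨k, hk⟩ := exists_isShortest hg.mem hg.ne_one hg.ne_neg_one w
  have hkg := hk.le g hg.mem hg.ne_one hg.ne_neg_one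
  have hc := hk.commute (hkg.trans hw) hg.mem hw
  obtain ⟨β, -, -, -, hβ⟩ := exists_tnorm_eq_of_commute hk.ne_one hk.ne_neg_one hc
  refine ⟨hg.mem, hg.ne_one, hg.ne_neg_one, fun h hh h1 h2 ↦ le_trans ?_ (hk.le h hh h1 h2)⟩
  have h3 := hg.le k hk.mem hk.ne_one hk.ne_neg_one
  have h4 := tnorm_pos hk.ne_one hk.ne_neg_one z
  have h5 := tnorm_pos hk.ne_one hk.ne_neg_one w
  rw [hβ] at h3
  have : β ^ 2 ≤ 1 := by
    by_contra! hlt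
    nlinarith
  rw [hβ]
  nlinarith

theorem ne_one_conj (h : SL(2, ℝ)) (hg : g ≠ 1) : h * g * h⁻¹ ≠ 1 := by
  rwa [Ne, conj_eq_one_iff]

theorem ne_neg_one_conj (h : SL(2, ℝ)) (hg : g ≠ -1) : h * g * h⁻¹ ≠ -1 := by
  intro H
  apply hg
  have : g = h⁻¹ * (h * g * h⁻¹) * h := by group
  rw [this, H]
  simp

theorem IsShortest.conj (hg : IsShortest G g z) (hh : h ∈ G) :
    IsShortest G (h * g * h⁻¹) (h • z) := by
  refine ⟨G.mul_mem (G.mul_mem hh hg.mem) (G.inv_mem hh), ne_one_conj h hg.ne_one,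
    ne_neg_one_conj h hg.ne_neg_one, fun k hk k1 k2 ↦ ?_⟩
  rw [tnorm_conj, tnorm_smul]
  refine hg.le _ (G.mul_mem (G.mul_mem (G.inv_mem hh) hk) hh) ?_ ?_
  · have := ne_one_conj h⁻¹ k1
    rwa [inv_inv] at this
  · have := ne_neg_one_conj h⁻¹ k2
    rwa [inv_inv] at this

/-- Slides a thin point, with the same shortest element, to the boundary of the thick part. -/
theorem IsShortest.exists_eq [DiscreteTopology G] (hg : IsShortest G g z)
    (hz : tnorm g z ≤ 1 / 64) : ∃ w, IsShortest G g w ∧ tnorm g w = 1 / 64 := by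
  obtain ⟨z', hz'⟩ := exists_le_tnorm hg.ne_one hg.ne_neg_one (1 / 64)
  obtain ⟨w, hw⟩ := mem_range_of_exists_le_of_exists_ge (continuous_tnorm g) ⟨z, hz⟩ ⟨z', hz'⟩
  exact ⟨w, hg.of_tnorm_le hw.le, hw⟩

/-- If the points where `G` has no short elements are compact modulo `G`, then every point is
either in a fixed compact set modulo `G`, or in one of finitely many cusp neighbourhoods. -/
theorem exists_compact_and_parabolics [DiscreteTopology G]
    (H : ∀ c : ℝ, 0 < c → ∃ K : Set ℍ, IsCompact K ∧
      ∀ w, (∀ h ∈ G, h ≠ 1 → h ≠ -1 → c ≤ tnorm h w) → ∃ h ∈ G, h • w ∈ K)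
    {c : ℝ} (hc : 0 < c) :
    ∃ (K : Set ℍ) (P : Set SL(2, ℝ)), IsCompact K ∧ P.Finite ∧
      (∀ g ∈ P, (g 0 0 + g 1 1) ^ 2 = 4) ∧
      ∀ z, (∃ h ∈ G, h • z ∈ K) ∨
        ∃ h ∈ G, ∃ g ∈ P, IsShortest G g (h • z) ∧ tnorm g (h • z) < c := by
  obtain ⟨K₀, hK₀, hthick⟩ := H (1 / 64) (by norm_num)
  have hE := finite_tnorm_le (G := G) hK₀ (1 / 64)
  set E := {g | g ∈ G ∧ ∃ z ∈ K₀, tnorm g z ≤ 1 / 64} with hEdef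
  -- The finitely many nonparabolic elements of `E` have `tnorm` bounded below everywhere through
  -- their traces. Below `c₁` only parabolic ones can occur.
  obtain ⟨c₁, hc₁, hc₁c, hc₁', hc₁E⟩ : ∃ c₁ : ℝ, 0 < c₁ ∧ c₁ ≤ c ∧ c₁ ≤ 1 / 64 ∧
      ∀ g ∈ E, (g 0 0 + g 1 1) ^ 2 ≠ 4 → c₁ ≤ |2 - (g 0 0 + g 1 1) ^ 2 / 2| := by
    have h1 : ∀ᶠ x : ℝ in nhdsWithin 0 (Set.Ioi 0), ∀ g ∈ E, (g 0 0 + g 1 1) ^ 2 ≠ 4 →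
        x ≤ |2 - (g 0 0 + g 1 1) ^ 2 / 2| := by
      rw [Filter.eventually_all_finite hE]
      intro g hg
      by_cases h4 : (g 0 0 + g 1 1) ^ 2 = 4
      · simp [h4]
      · have : 0 < |2 - (g 0 0 + g 1 1) ^ 2 / 2| := by
          rw [abs_pos]
          intro h5
          apply h4
          linarith
        filter_upwards [nhdsWithin_le_nhds (eventually_le_nhds this)] with x hx _ using hx
    obtain ⟨x, ⟨⟨hx1, hx2⟩, hx3⟩, hx4⟩ := ((h1.and (nhdsWithin_le_nhds (eventually_le_nhds hc))).and
      (nhdsWithin_le_nhds (eventually_le_nhds (show (0 : ℝ) < 1 / 64 by norm_num)))).and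
      self_mem_nhdsWithin |>.exists
    exact ⟨x, hx4, hx2, hx3, hx1⟩
  obtain ⟨K, hK, hKthick⟩ := H c₁ hc₁
  refine ⟨K, {g ∈ E | (g 0 0 + g 1 1) ^ 2 = 4}, hK, hE.subset (Set.sep_subset _ _),
    fun g hg ↦ hg.2, fun z ↦ ?_⟩
  by_cases hz : ∀ h ∈ G, h ≠ 1 → h ≠ -1 → c₁ ≤ tnorm h z
  · exact Or.inl (hKthick z hz)
  · right
    push Not at hz
    obtain ⟨k, hkG, hk1, hk2, hkz⟩ := hz
    obtain ⟨g, hg⟩ := exists_isShortest hkG hk1 hk2 z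
    have hgz : tnorm g z < c₁ := (hg.le k hkG hk1 hk2).trans_lt hkz
    obtain ⟨w, hw, hgw⟩ := hg.exists_eq (by linarith)
    obtain ⟨h, hh, hhw⟩ := hthick w fun k hk k1 k2 ↦ hgw.symm.le.trans (hw.le k hk k1 k2)
    have hs := hg.conj hh
    have hE' : h * g * h⁻¹ ∈ E := ⟨hs.mem, h • w, hhw, by rw [tnorm_conj, hgw]⟩
    refine ⟨h, hh, h * g * h⁻¹, ⟨hE', ?_⟩, hs, by rw [tnorm_conj]; linarith⟩
    by_contra h4
    have h5 := (hc₁E _ hE' h4).trans (abs_trace_le_tnorm _ (h • z))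
    rw [tnorm_conj] at h5
    linarith

/-- Normal form of parabolic elements. -/
theorem exists_parabolic_conj (h1 : g ≠ 1) (h2 : g ≠ -1) (ht : (g 0 0 + g 1 1) ^ 2 = 4) :
    ∃ σ : SL(2, ℝ), (σ⁻¹ * g * σ) 1 0 = 0 ∧ (σ⁻¹ * g * σ) 0 0 = (σ⁻¹ * g * σ) 1 1 ∧
      ((σ⁻¹ * g * σ) 0 1) ^ 2 = 1 := by
  have triangular : ∀ m : SL(2, ℝ), m ≠ 1 → m ≠ -1 → (m 0 0 + m 1 1) ^ 2 = 4 → m 1 0 = 0 →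
      ∃ σ : SL(2, ℝ), (σ⁻¹ * m * σ) 1 0 = 0 ∧ (σ⁻¹ * m * σ) 0 0 = (σ⁻¹ * m * σ) 1 1 ∧
      ((σ⁻¹ * m * σ) 0 1) ^ 2 = 1 := by
    intro m m1 m2 mt m0
    have hd := sl_det m
    rw [m0] at hd
    have e : m 0 0 = m 1 1 := by
      have : (m 0 0 - m 1 1) ^ 2 = 0 := by nlinarith
      have := pow_eq_zero_iff (two_ne_zero) |>.mp this
      linarith
    have hb : m 0 1 ≠ 0 := by
      intro hb
      rcases eq_one_or_neg_one_of_scalar e hb m0 with h | h <;> contradiction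
    have hs : 0 < √|m 0 1| := Real.sqrt_pos.mpr (abs_pos.mpr hb)
    have hs2 : √|m 0 1| ^ 2 = |m 0 1| := Real.sq_sqrt (abs_nonneg _)
    set t := √|m 0 1| with ht
    -- Conjugating by this dilation divides the translation length by `t ^ 2 = |m 0 1|`.
    let σ : SL(2, ℝ) := ⟨!![t, 0; 0, t⁻¹], by simp [hs.ne']⟩
    have s00 : σ 0 0 = t := rfl
    have s01 : σ 0 1 = 0 := rfl
    have s10 : σ 1 0 = 0 := rfl
    have s11 : σ 1 1 = t⁻¹ := rfl
    obtain ⟨i1, i2, i3, i4⟩ := sl_inv_entries σ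
    refine ⟨σ, ?_, ?_, ?_⟩
    · simp [sl_mul_apply, i1, i2, i3, i4, s00, s01, s10, s11, m0]
    · simp only [sl_mul_apply, i1, i2, i3, i4, s00, s01, s10, s11, m0]
      field_simp
      simp [e]
    · simp only [sl_mul_apply, i1, i2, i3, i4, s00, s01, s10, s11, m0]
      have : (t⁻¹ * m 0 1 * t⁻¹) ^ 2 = (m 0 1) ^ 2 / (t ^ 2) ^ 2 := by field_simp
      simp only [neg_zero, mul_zero, zero_mul, add_zero, zero_add]
      rw [this, hs2, sq_abs]
      field_simp
  by_cases hc : g 1 0 = 0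
  · exact triangular g h1 h2 ht hc
  -- This is the unique fixed point of `g` on the boundary, and `τ` below carries infinity to it.
  · set x := (g 0 0 - g 1 1) / (2 * g 1 0) with hx
    let τ : SL(2, ℝ) := ⟨!![x, -1; 1, 0], by simp⟩
    have s00 : τ 0 0 = x := rfl
    have s01 : τ 0 1 = -1 := rfl
    have s10 : τ 1 0 = 1 := rfl
    have s11 : τ 1 1 = 0 := rfl
    obtain ⟨i1, i2, i3, i4⟩ := sl_inv_entries τ
    have hm := ne_one_conj τ⁻¹ h1
    have hm' := ne_neg_one_conj τ⁻¹ h2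
    have htr := trace_conj τ⁻¹ g
    rw [inv_inv] at hm hm' htr
    obtain ⟨σ, H⟩ := triangular (τ⁻¹ * g * τ) hm hm' (by rw [htr]; exact ht) (by
      simp only [sl_mul_apply, i1, i2, i3, i4, s00, s01, s10, s11, hx]
      have := sl_det g
      field_simp
      nlinarith)
    refine ⟨τ * σ, ?_⟩
    have : (τ * σ)⁻¹ * g * (τ * σ) = σ⁻¹ * (τ⁻¹ * g * τ) * σ := by group
    rwa [this]

theorem tnorm_of_upper {m : SL(2, ℝ)} (h10 : m 1 0 = 0) (he : m 0 0 = m 1 1) (z : ℍ) :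
    tnorm m z = (m 0 1) ^ 2 / z.im ^ 2 := by
  rw [tnorm_eq, h10, he]
  simp

/-- In a neighbourhood of a cusp, every element that moves a point by at most `2` is, up to sign,
a translation. -/
theorem IsShortest.upper_of_dist_le [DiscreteTopology G] {γ σ δ : SL(2, ℝ)} {w : ℍ}
    (hγ : IsShortest G γ (σ • w))
    (h10 : (σ⁻¹ * γ * σ) 1 0 = 0) (he : (σ⁻¹ * γ * σ) 0 0 = (σ⁻¹ * γ * σ) 1 1)
    (h01 : ((σ⁻¹ * γ * σ) 0 1) ^ 2 = 1) (hw : 64 ≤ w.im) (hδ : δ ∈ G)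
    (hd : dist (σ • w) (δ • σ • w) ≤ 2) :
    (σ⁻¹ * δ * σ) 1 0 = 0 ∧ (σ⁻¹ * δ * σ) 0 0 = (σ⁻¹ * δ * σ) 1 1 ∧
      (σ⁻¹ * δ * σ) 0 0 ^ 2 = 1 := by
  set T := σ⁻¹ * γ * σ with hT
  have hwpos := w.im_pos
  have hγT : γ = σ * T * σ⁻¹ := by rw [hT]; group
  have hnorm : ∀ v : ℍ, tnorm γ (σ • v) = 1 / v.im ^ 2 := by
    intro v
    rw [hγT, tnorm_conj, tnorm_of_upper h10 he, h01]
  have hw1 : (1 : ℝ) / w.im ^ 2 ≤ 1 / 64 := by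
    apply one_div_le_one_div_of_le (by norm_num)
    nlinarith
  -- As `exp 2 < 8`, the point `m⁻¹ • w` still has height at least `64 / 8 = 8`, so `ε * γ * ε⁻¹`
  -- has `tnorm` at most `1 / 8 ^ 2 = 1/64` at `σ • w`. It therefore commutes with `γ`, and `ε`
  -- fixes the cusp. Minimality of `γ` says that conjugation by `ε` does not shorten the
  -- translation.
  have key : ∀ ε ∈ G, dist (σ • w) (ε • σ • w) ≤ 2 →
      (σ⁻¹ * ε * σ) 1 0 = 0 ∧ 1 ≤ (σ⁻¹ * ε * σ) 0 0 ^ 4 := by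
    intro ε hε hdε
    set m := σ⁻¹ * ε * σ with hm
    have hεm : ε = σ * m * σ⁻¹ := by rw [hm]; group
    have hconj : ε * γ * ε⁻¹ = σ * (m * T * m⁻¹) * σ⁻¹ := by rw [hm, hT]; group
    have hn : tnorm (ε * γ * ε⁻¹) (σ • w) ≤ 1 / 64 := by
      have e1 : σ • w = ε • (σ • (m⁻¹ • w)) := by
        rw [← mul_smul, ← mul_smul, hm]
        congr 1
        group
      rw [e1, tnorm_conj, hnorm]
      have h2 : dist w (m⁻¹ • w) ≤ 2 := by
        have : dist w (m⁻¹ • w) = dist (σ • w) (ε • σ • w) := by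
          have e2 : ε • σ • w = σ • m • w := by
            rw [← mul_smul, ← mul_smul, hm]
            congr 1
            group
          rw [dist_comm, ← dist_smul m (m⁻¹ • w), smul_inv_smul, e2, dist_smul]
        linarith
      have h3 := UpperHalfPlane.im_le_im_mul_exp_dist w (m⁻¹ • w)
      have h4 : Real.exp (dist w (m⁻¹ • w)) ≤ 8 := by
        have h5 := Real.exp_le_exp.mpr h2
        have h6 : Real.exp 2 = Real.exp 1 * Real.exp 1 := by rw [← Real.exp_add]; norm_num
        have h7 := Real.exp_one_lt_d9
        have h8 := Real.exp_pos 1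
        nlinarith
      have h5 := (m⁻¹ • w).im_pos
      have h6 : 8 ≤ (m⁻¹ • w).im := by nlinarith
      apply one_div_le_one_div_of_le (by norm_num)
      nlinarith
    have hmem : ε * γ * ε⁻¹ ∈ G := G.mul_mem (G.mul_mem hε hγ.mem) (G.inv_mem hε)
    have hcomm := hγ.commute ((hnorm w).le.trans hw1) hmem hn
    have hcomm' : T * (m * T * m⁻¹) = m * T * m⁻¹ * T := by
      rw [hconj, hγT] at hcomm
      have h := congrArg (fun x ↦ σ⁻¹ * x * σ) hcomm
      simp only [mul_assoc, inv_mul_cancel_left] at h ⊢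
      simpa using h
    have hT1 : T ≠ 1 := by
      have := ne_one_conj σ⁻¹ hγ.ne_one
      rwa [inv_inv] at this
    have hT2 : T ≠ -1 := by
      have := ne_neg_one_conj σ⁻¹ hγ.ne_neg_one
      rwa [inv_inv] at this
    obtain ⟨β, -, h3, -, -⟩ := exists_tnorm_eq_of_commute hT1 hT2 hcomm'
    obtain ⟨i1, i2, i3, i4⟩ := sl_inv_entries m
    have hdm := sl_det m
    rw [h10, mul_zero] at h3
    have hm10 : m 1 0 = 0 := by
      simp only [sl_mul_apply, i1, i2, i3, i4, h10, he] at h3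
      have : m 1 0 ^ 2 * T 0 1 = 0 := by linarith
      rcases mul_eq_zero.mp this with h | h
      · simpa using h
      · rw [h] at h01; norm_num at h01
    refine ⟨hm10, ?_⟩
    have hle := hγ.le _ hmem (ne_one_conj ε hγ.ne_one) (ne_neg_one_conj ε hγ.ne_neg_one)
    have e00 : (m * T * m⁻¹) 0 0 = T 0 0 := by
      simp only [sl_mul_apply, i1, i2, i3, i4, h10, hm10]
      rw [hm10] at hdm
      linear_combination T 0 0 * hdm
    have e11 : (m * T * m⁻¹) 1 1 = T 1 1 := by
      simp only [sl_mul_apply, i1, i2, i3, i4, h10, hm10]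
      rw [hm10] at hdm
      linear_combination T 1 1 * hdm
    have e01 : (m * T * m⁻¹) 0 1 = m 0 0 ^ 2 * T 0 1 := by
      simp only [sl_mul_apply, i1, i2, i3, i4, h10, hm10, he]
      ring
    rw [hnorm, hconj, tnorm_conj, tnorm_of_upper h3 (by rw [e00, e11, he]), e01, mul_pow, h01,
      div_le_div_iff_of_pos_right (by positivity)] at hle
    calc (1 : ℝ) ≤ _ := hle
      _ = _ := by ring
  obtain ⟨a1, a2⟩ := key δ hδ hd
  -- Applied to `δ⁻¹` as well, `key` rules out lengthening, so the diagonal entries are `±1`.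
  have hd' : dist (σ • w) (δ⁻¹ • σ • w) ≤ 2 := by
    rw [dist_comm, ← dist_smul δ (δ⁻¹ • σ • w), smul_inv_smul]
    exact hd
  obtain ⟨b1, b2⟩ := key δ⁻¹ (G.inv_mem hδ) hd'
  have hinv : σ⁻¹ * δ⁻¹ * σ = (σ⁻¹ * δ * σ)⁻¹ := by group
  set m := σ⁻¹ * δ * σ with hm
  rw [hinv, (sl_inv_entries m).1] at b2
  have hdm := sl_det m
  rw [a1] at hdm
  have hps : m 0 0 * m 1 1 = 1 := by linarith
  have h1 : (1 : ℝ) ≤ m 0 0 ^ 2 := by nlinarith [sq_nonneg (m 0 0)]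
  have h2 : (1 : ℝ) ≤ m 1 1 ^ 2 := by nlinarith [sq_nonneg (m 1 1)]
  have h3 : m 0 0 ^ 2 * m 1 1 ^ 2 = 1 := by rw [← mul_pow, hps, one_pow]
  have h4 : m 0 0 ^ 2 = 1 := by nlinarith
  refine ⟨a1, ?_, h4⟩
  have : m 0 0 * (m 0 0 - m 1 1) = 0 := by nlinarith
  rcases mul_eq_zero.mp this with h | h
  · rw [h] at h4; norm_num at h4
  · linarith

end

/-! ### Lifting `Γ` to matrices, unfolding, and counting elements of small displacement. -/

section

/-- The full preimage of `Γ` in `SL(2, ℝ)`. -/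
def slLift (Γ : Subgroup PSL(2, ℝ)) : Subgroup SL(2, ℝ) :=
  Γ.comap (QuotientGroup.mk' (Subgroup.center SL(2, ℝ)))

theorem mem_center_sl {g : SL(2, ℝ)} :
    g ∈ Subgroup.center SL(2, ℝ) ↔ g = 1 ∨ g = -1 := by
  constructor
  · intro h
    rw [Matrix.SpecialLinearGroup.mem_center_iff] at h
    obtain ⟨r, -, hr⟩ := h
    apply eq_one_or_neg_one_of_scalar <;> rw [← hr] <;> simp
  · rintro (rfl | rfl)
    · exact Subgroup.one_mem _
    · rw [Subgroup.mem_center_iff]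
      intro g
      simp

variable {Γ : Subgroup PSL(2, ℝ)}

theorem discreteTopology_slLift (hΓ : DiscreteTopology Γ) : DiscreteTopology (slLift Γ) := by
  obtain ⟨U, hU, hU1⟩ := isOpen_induced_iff.mp (isOpen_discrete ({1} : Set Γ))
  refine discreteTopology_of_isOpen_singleton_one ?_
  -- The image in `PSL(2, ℝ)` isolates `±1`; positivity of the trace then separates `1` from `-1`.
  have hV : IsOpen ({g : SL(2, ℝ) | (QuotientGroup.mk g : PSL(2, ℝ)) ∈ U} ∩
      {g : SL(2, ℝ) | 0 < g 0 0 + g 1 1}) := by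
    refine (hU.preimage QuotientGroup.continuous_mk).inter (isOpen_lt continuous_const ?_)
    have h : Continuous fun g : SL(2, ℝ) ↦ (g : Matrix (Fin 2) (Fin 2) ℝ) :=
      continuous_subtype_val
    exact (h.matrix_elem 0 0).add (h.matrix_elem 1 1)
  convert hV.preimage (continuous_subtype_val : Continuous ((↑) : slLift Γ → SL(2, ℝ)))
  ext ⟨g, hg⟩
  have key : ∀ γ : Γ, (γ : PSL(2, ℝ)) ∈ U ↔ γ = 1 := fun γ ↦ by
    have := Set.ext_iff.mp hU1 γ
    simpa using this
  have hgΓ : (QuotientGroup.mk g : PSL(2, ℝ)) ∈ Γ := hg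
  have h2 := key ⟨_, hgΓ⟩
  simp only [Set.mem_singleton_iff, Set.mem_preimage, Set.mem_inter_iff, Set.mem_ofPred_eq]
  simp only [Subtype.ext_iff, Subgroup.coe_one] at h2 ⊢
  rw [h2]
  constructor
  · rintro rfl
    exact ⟨rfl, by simp⟩
  · rintro ⟨h3, h4⟩
    rcases mem_center_sl.mp ((QuotientGroup.eq_one_iff g).mp h3) with h | h
    · exact h
    · rw [h] at h4
      norm_num at h4

/-- A matrix representing an element of `Γ`. -/
def repr (γ : Γ) : SL(2, ℝ) := Quotient.out γ.1

theorem mk_repr (γ : Γ) : (QuotientGroup.mk (repr γ) : PSL(2, ℝ)) = γ := Quotient.out_eq' γ.1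

theorem repr_mem (γ : Γ) : repr γ ∈ slLift Γ := by
  change (QuotientGroup.mk (repr γ) : PSL(2, ℝ)) ∈ Γ
  rw [mk_repr]
  exact γ.2

theorem smul_eq_repr (γ : Γ) (z : ℍ) : γ • z = repr γ • z := by
  change (γ : PSL(2, ℝ)) • z = _
  rw [← mk_repr γ]
  rfl

theorem exists_smul_eq {g : SL(2, ℝ)} (hg : g ∈ slLift Γ) :
    ∃ γ : Γ, ∀ z : ℍ, γ • z = g • z :=
  ⟨⟨QuotientGroup.mk g, hg⟩, fun _ ↦ rfl⟩

theorem repr_ne {γ δ : Γ} (h : γ ≠ δ) :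
    (repr γ)⁻¹ * repr δ ≠ 1 ∧ (repr γ)⁻¹ * repr δ ≠ -1 := by
  rw [← not_or, ← mem_center_sl, ← QuotientGroup.eq, mk_repr, mk_repr]
  exact fun h' ↦ h (Subtype.ext h')

theorem repr_injective : Function.Injective (repr : Γ → SL(2, ℝ)) := by
  intro γ δ h
  by_contra hne
  have := (repr_ne hne).1
  rw [h] at this
  simp at this

instance : ContinuousConstSMul Γ ℍ where
  continuous_const_smul γ := by
    simp only [smul_eq_repr]
    exact continuous_const_smul _

instance : IsIsometricSMul Γ ℍ where
  isometry_smul γ := by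
    have : (fun z : ℍ ↦ γ • z) = fun z ↦ repr γ • z := funext fun z ↦ smul_eq_repr γ z
    exact this ▸ isometry_smul ℍ (repr γ)

theorem volume_preimage_sl_smul (g : SL(2, ℝ)) {s : Set ℍ} (hs : MeasurableSet s) :
    volume ((fun z : ℍ ↦ g • z) ⁻¹' s) = volume s :=
  SMulInvariantMeasure.measure_preimage_smul (g : GL (Fin 2) ℝ) hs

instance : SMulInvariantMeasure Γ ℍ volume where
  measure_preimage_smul γ s hs := by
    have : (fun z : ℍ ↦ γ • z) = fun z ↦ repr γ • z := funext fun z ↦ smul_eq_repr γ z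
    rw [this]
    exact volume_preimage_sl_smul _ hs

theorem countable_of_discrete [DiscreteTopology (slLift Γ)] : Countable Γ := by
  have hc : (⋃ n : ℕ, {g | g ∈ slLift Γ ∧ ∃ z ∈ Metric.closedBall I (n : ℝ),
      g • z ∈ Metric.closedBall I (n : ℝ)}).Countable :=
    Set.countable_iUnion fun n ↦ (finite_smul_inter (isCompact_closedBall _ _)
      (isCompact_closedBall _ _)).countable
  have hG : ((slLift Γ : Subgroup SL(2, ℝ)) : Set SL(2, ℝ)).Countable := by
    refine hc.mono fun g hg ↦ ?_
    obtain ⟨n, hn⟩ := exists_nat_ge (dist (g • I) I)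
    exact Set.mem_iUnion.mpr ⟨n, hg, I, by simp, hn⟩
  have := hG.to_subtype
  exact Function.Injective.countable (f := fun γ : Γ ↦ (⟨repr γ, repr_mem γ⟩ : slLift Γ))
    fun γ δ h ↦ repr_injective (congrArg Subtype.val h)

theorem volume_ball_pos (z : ℍ) : 0 < volume (Metric.ball z 1) := by
  rw [volume_eq_lintegral]
  have ho : IsOpen (UpperHalfPlane.coe '' Metric.ball z 1) :=
    isOpenEmbedding_coe.isOpenMap _ Metric.isOpen_ball
  rw [setLIntegral_pos_iff (by fun_prop)]
  refine (ho.measure_pos volume ⟨z, z, Metric.mem_ball_self one_pos, rfl⟩).trans_le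
    (measure_mono ?_)
  rintro _ ⟨w, hw, rfl⟩
  refine ⟨?_, w, hw, rfl⟩
  simp [w.im_ne_zero]

theorem volume_ball_eq (z w : ℍ) (r : ℝ) :
    volume (Metric.ball z r) = volume (Metric.ball w r) := by
  obtain ⟨g, rfl⟩ := MulAction.exists_smul_eq SL(2, ℝ) w z
  rw [← volume_preimage_sl_smul g Metric.isOpen_ball.measurableSet]
  congr 1
  ext x
  simp

/-- At most `N` elements of `Γ` move `z` by at most `R`. -/
def DisplacementBound (Γ : Subgroup PSL(2, ℝ)) (z : ℍ) (R N : ℝ) : Prop :=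
  ∀ s : Finset Γ, (∀ γ ∈ s, dist z (γ • z) ≤ R) → (s.card : ℝ) ≤ N

/-- `Γ`-orbits meet a set `B` in at most `N` points, counted with multiplicity. -/
def MultiplicityBound (Γ : Subgroup PSL(2, ℝ)) (B : Set ℍ) (N : ℝ) : Prop :=
  ∀ (x : ℍ) (s : Finset Γ), (∀ γ ∈ s, γ • x ∈ B) → (s.card : ℝ) ≤ N

theorem DisplacementBound.nonneg {z : ℍ} {R N : ℝ} (h : DisplacementBound Γ z R N) : 0 ≤ N := by
  simpa using h ∅ (by simp)

/-- If two points of an orbit lie within `r` of `w`, the element carrying one to the other moves `w`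
by less than `2 * r`. The centre may depend on the point, which allows `B` to be a union of balls.
-/
theorem multiplicityBound_of_subset {B : Set ℍ} {N r : ℝ} (hN : 0 ≤ N)
    (hB : ∀ x ∈ B, ∃ w, DisplacementBound Γ w (2 * r) N ∧
      ∀ γ : Γ, γ • x ∈ B → dist x w < r ∧ dist (γ • x) w < r) :
    MultiplicityBound Γ B N := by
  classical
  intro x s hs
  rcases s.eq_empty_or_nonempty with rfl | ⟨γ₀, hγ₀⟩
  · simpa using hN
  obtain ⟨w, hw, hB⟩ := hB _ (hs γ₀ hγ₀)
  have hinj : Function.Injective fun γ : Γ ↦ γ * γ₀⁻¹ := mul_left_injective _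
  rw [← Finset.card_image_of_injective s hinj]
  refine hw _ fun δ hδ ↦ ?_
  obtain ⟨γ, hγ, rfl⟩ := Finset.mem_image.mp hδ
  obtain ⟨h1, h2⟩ := hB (γ * γ₀⁻¹) (by simpa [mul_smul] using hs γ hγ)
  have h3 : dist ((γ * γ₀⁻¹) • γ₀ • x) ((γ * γ₀⁻¹) • w) < r := by rwa [dist_smul]
  have := dist_triangle_left w ((γ * γ₀⁻¹) • w) ((γ * γ₀⁻¹) • γ₀ • x)
  linarith

theorem multiplicityBound_of_subset_ball {B : Set ℍ} {w : ℍ} {N r : ℝ}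
    (hB : B ⊆ Metric.ball w r) (h : DisplacementBound Γ w (2 * r) N) :
    MultiplicityBound Γ B N :=
  multiplicityBound_of_subset h.nonneg fun _ hx ↦ ⟨w, h, fun _ hγ ↦ ⟨hB hx, hB hγ⟩⟩

/-- Unfolding inequality. -/
theorem setLIntegral_le_of_multiplicityBound [Countable Γ] {F B : Set ℍ} {N : ℝ}
    (hF : IsFundamentalDomain Γ F (volume : Measure ℍ)) (hB : MeasurableSet B)
    (hN : MultiplicityBound Γ B N) {φ : ℍ → ENNReal} (hφ : Measurable φ)
    (hinv : ∀ (γ : Γ) z, φ (γ • z) = φ z) :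
    ∫⁻ z in B, φ z ≤ ENNReal.ofReal N * ∫⁻ z in F, φ z := by
  rw [← lintegral_indicator hB, hF.lintegral_eq_tsum'', ← lintegral_tsum,
    ← lintegral_const_mul _ hφ]
  · refine lintegral_mono fun x ↦ ?_
    rw [ENNReal.tsum_eq_iSup_sum]
    refine iSup_le fun s ↦ ?_
    classical
    have h1 : ∀ γ ∈ s, B.indicator φ (γ • x) = if γ • x ∈ B then φ x else 0 := fun γ _ ↦ by
      rw [Set.indicator_apply, hinv]
    rw [Finset.sum_congr rfl h1, ← Finset.sum_filter, Finset.sum_const, nsmul_eq_mul]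
    gcongr
    have := hN x (s.filter fun γ ↦ γ • x ∈ B) fun γ hγ ↦ (Finset.mem_filter.mp hγ).2
    rw [← ENNReal.ofReal_natCast]
    exact ENNReal.ofReal_le_ofReal this
  · intro γ
    exact ((hφ.indicator hB).comp (measurable_const_smul γ)).aemeasurable

/-- Points at which `Γ` has no short elements satisfy a uniform displacement bound. -/
theorem exists_displacementBound_of_thick {c : ℝ} (hc : 0 < c) (R : ℝ) :
    ∃ M : ℝ, ∀ w : ℍ, (∀ h ∈ slLift Γ, h ≠ 1 → h ≠ -1 → c ≤ tnorm h w) →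
      DisplacementBound Γ w R M := by
  classical
  obtain ⟨M, hM⟩ := exists_card_le_of_separated hc R
  refine ⟨M, fun w hw s hs ↦ ?_⟩
  rw [← Finset.card_image_of_injective s repr_injective]
  refine Nat.cast_le.mpr (hM w _ ?_ ?_)
  · intro g hg
    obtain ⟨γ, hγ, rfl⟩ := Finset.mem_image.mp hg
    rw [← smul_eq_repr]
    exact hs γ hγ
  · intro g hg h hh hne
    obtain ⟨γ, hγ, rfl⟩ := Finset.mem_image.mp hg
    obtain ⟨δ, hδ, rfl⟩ := Finset.mem_image.mp hh
    have := repr_ne (γ := γ) (δ := δ) (fun h ↦ hne (by rw [h]))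
    exact hw _ ((slLift Γ).mul_mem ((slLift Γ).inv_mem (repr_mem γ)) (repr_mem δ)) this.1 this.2

/-- For a cofinite group, the set of points without short elements is compact modulo the group. -/
theorem exists_compact_of_thick [Countable Γ] {F : Set ℍ}
    (hF : IsFundamentalDomain Γ F (volume : Measure ℍ)) (hvol : volume F < ⊤) {c : ℝ}
    (hc : 0 < c) : ∃ K : Set ℍ, IsCompact K ∧
      ∀ w, (∀ h ∈ slLift Γ, h ≠ 1 → h ≠ -1 → c ≤ tnorm h w) → ∃ h ∈ slLift Γ, h • w ∈ K := by
  classical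
  obtain ⟨M, hM⟩ := exists_displacementBound_of_thick (Γ := Γ) hc 2
  set W := {w : ℍ | ∀ h ∈ slLift Γ, h ≠ 1 → h ≠ -1 → c ≤ tnorm h w} with hW
  -- Thick points pairwise at distance at least `2` modulo `Γ`. Their unit balls have equal volume
  -- and unfold into `F` with multiplicity at most `M`, so finite area bounds their number. A
  -- maximal such set is a `2`-net of the thick part modulo `Γ`.
  let Sep : Finset ℍ → Prop := fun t ↦ (∀ w ∈ t, w ∈ W) ∧
    ∀ w ∈ t, ∀ v ∈ t, ∀ γ : Γ, dist w (γ • v) < 2 → w = v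
  have hcard : ∀ t, Sep t → (t.card : ENNReal) * volume (Metric.ball I 1) ≤
      ENNReal.ofReal M * volume F := by
    rintro t ⟨htW, htS⟩
    rcases t.eq_empty_or_nonempty with rfl | ⟨w₀, hw₀⟩
    · simp
    have hdisj : (t : Set ℍ).PairwiseDisjoint fun w ↦ Metric.ball w 1 := by
      intro w hw v hv hne
      refine Metric.ball_disjoint_ball ?_
      by_contra! hlt
      refine hne (htS w hw v hv 1 ?_)
      rw [one_smul]
      linarith
    have h1 := measure_biUnion_finset (μ := (volume : Measure ℍ)) hdisj
      fun w _ ↦ Metric.isOpen_ball.measurableSet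
    have h2 : ∑ w ∈ t, volume (Metric.ball w 1) = t.card * volume (Metric.ball I 1) := by
      rw [Finset.sum_congr rfl fun w _ ↦ volume_ball_eq w I 1, Finset.sum_const, nsmul_eq_mul]
    have hmult : MultiplicityBound Γ (⋃ w ∈ t, Metric.ball w 1) M := by
      refine multiplicityBound_of_subset (r := 1) (hM w₀ (htW w₀ hw₀)).nonneg fun x hx ↦ ?_
      obtain ⟨w, hw, hxw⟩ := Set.mem_iUnion₂.mp hx
      refine ⟨w, by simpa using hM w (htW w hw), fun γ hγ ↦ ⟨hxw, ?_⟩⟩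
      obtain ⟨v, hv, hxv⟩ := Set.mem_iUnion₂.mp hγ
      have : v = w := by
        refine htS v hv w hw γ ?_
        have h3 : dist (γ • x) (γ • w) < 1 := by rwa [dist_smul]
        have h4 : dist (γ • x) v < 1 := hxv
        linarith [dist_triangle_left v (γ • w) (γ • x)]
      rw [← this]
      exact hxv
    have h3 := setLIntegral_le_of_multiplicityBound (φ := fun _ ↦ 1) hF
      (Finset.measurableSet_biUnion t fun w _ ↦ Metric.isOpen_ball.measurableSet) hmult
      measurable_const fun _ _ ↦ rfl
    simpa [h1, h2] using h3
  obtain ⟨n, hn⟩ : ∃ n : ℕ, ∀ t, Sep t → t.card ≤ n := by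
    have hv := volume_ball_pos I
    have htop : ENNReal.ofReal M * volume F / volume (Metric.ball I 1) < ⊤ :=
      ENNReal.div_lt_top (ENNReal.mul_lt_top ENNReal.ofReal_lt_top hvol).ne hv.ne'
    obtain ⟨n, hn⟩ := ENNReal.exists_nat_gt htop.ne
    refine ⟨n, fun t ht ↦ ?_⟩
    have h1 := hcard t ht
    rw [← ENNReal.le_div_iff_mul_le (Or.inl hv.ne')
      (Or.inl (measure_ball_lt_top).ne)] at h1
    exact_mod_cast (h1.trans_lt hn).le
  obtain ⟨t, ht, hmax⟩ : ∃ t, Sep t ∧ ∀ t', Sep t' → t'.card ≤ t.card := by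
    have hex : ∃ m, ∃ t, Sep t ∧ t.card = m := ⟨0, ∅, by simp [Sep], rfl⟩
    have hb : ∀ m, (∃ t, Sep t ∧ t.card = m) → m ≤ n := by
      rintro _ ⟨t, ht, rfl⟩
      exact hn t ht
    obtain ⟨t, ht, hcard⟩ := Nat.findGreatest_spec (P := fun m ↦ ∃ t, Sep t ∧ t.card = m)
      (hb _ hex.choose_spec) hex.choose_spec
    exact ⟨t, ht, fun t' ht' ↦ hcard ▸ Nat.le_findGreatest (hn t' ht') ⟨t', ht', rfl⟩⟩
  refine ⟨⋃ w ∈ t, Metric.closedBall w 2,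
    t.finite_toSet.isCompact_biUnion fun w _ ↦ isCompact_closedBall _ _, fun w hw ↦ ?_⟩
  by_contra! H
  have hfar : ∀ v ∈ t, ∀ γ : Γ, 2 ≤ dist v (γ • w) := by
    intro v hv γ
    by_contra! hlt
    refine H (repr γ) (repr_mem γ) (Set.mem_iUnion₂.mpr ⟨v, hv, ?_⟩)
    rw [Metric.mem_closedBall, ← smul_eq_repr, dist_comm]
    exact hlt.le
  have hnot : w ∉ t := by
    intro hwt
    have := hfar w hwt 1
    rw [one_smul, dist_self] at this
    linarith
  have hins : Sep (insert w t) := by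
    refine ⟨fun v hv ↦ ?_, fun u hu v hv γ hd ↦ ?_⟩
    · rcases Finset.mem_insert.mp hv with rfl | hv
      · exact hw
      · exact ht.1 v hv
    · rcases Finset.mem_insert.mp hu with rfl | hu' <;>
        rcases Finset.mem_insert.mp hv with rfl | hv'
      · rfl
      · exfalso
        have := hfar v hv' γ⁻¹
        rw [← dist_smul γ, smul_inv_smul, dist_comm] at this
        linarith
      · exfalso
        have := hfar u hu' γ
        linarith
      · exact ht.2 u hu' v hv' γ hd
  have := hmax _ hins
  rw [Finset.card_insert_of_notMem hnot] at this
  omega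

/-- Points of a compact set satisfy a uniform displacement bound. -/
theorem exists_displacementBound_of_compact [DiscreteTopology (slLift Γ)] {K : Set ℍ}
    (hK : IsCompact K) (R : ℝ) : ∃ M : ℝ, ∀ w ∈ K, DisplacementBound Γ w R M := by
  classical
  have hfin := finite_smul_inter (G := slLift Γ) hK (hK.cthickening (r := R))
  refine ⟨hfin.toFinset.card, fun w hw s hs ↦ ?_⟩
  rw [← Finset.card_image_of_injective s repr_injective]
  refine Nat.cast_le.mpr (Finset.card_le_card fun g hg ↦ ?_)
  obtain ⟨γ, hγ, rfl⟩ := Finset.mem_image.mp hg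
  rw [Set.Finite.mem_toFinset]
  refine ⟨repr_mem γ, w, hw, Metric.mem_cthickening_of_dist_le _ w _ _ hw ?_⟩
  rw [← smul_eq_repr, dist_comm]
  exact hs γ hγ

/-- The displacement bound in a neighbourhood of a cusp. -/
theorem IsShortest.displacementBound [DiscreteTopology (slLift Γ)] {γ σ : SL(2, ℝ)} {w : ℍ}
    (hγ : IsShortest (slLift Γ) γ (σ • w))
    (h10 : (σ⁻¹ * γ * σ) 1 0 = 0) (he : (σ⁻¹ * γ * σ) 0 0 = (σ⁻¹ * γ * σ) 1 1)
    (h01 : ((σ⁻¹ * γ * σ) 0 1) ^ 2 = 1) (hw : 64 ≤ w.im) {R : ℝ} (hR : 0 ≤ R) (hR1 : R ≤ 1) :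
    DisplacementBound Γ (σ • w) R (4 * w.im * R + 2) := by
  classical
  intro s hs
  set m : Γ → SL(2, ℝ) := fun δ ↦ σ⁻¹ * repr δ * σ with hm
  have hup : ∀ δ ∈ s, m δ 1 0 = 0 ∧ m δ 0 0 = m δ 1 1 ∧ m δ 0 0 ^ 2 = 1 := by
    intro δ hδ
    refine hγ.upper_of_dist_le h10 he h01 hw (repr_mem δ) ?_
    rw [← smul_eq_repr]
    linarith [hs δ hδ]
  have hy := w.im_pos
  set L := 2 * w.im * R with hL
  have hL0 : 0 ≤ L := by positivity
  -- Since `m δ` is `±` a unipotent matrix, this product is its signed translation length. A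
  -- displacement at most `R ≤ 1` at height `w.im` bounds it, through `cosh R ≤ exp (R ^ 2 / 2) ≤ 1
  -- + R ^ 2`.
  have hbound : ∀ δ ∈ s, |m δ 0 0 * m δ 0 1| ≤ L := by
    intro δ hδ
    obtain ⟨a1, a2, a3⟩ := hup δ hδ
    have h1 : dist w (m δ • w) ≤ R := by
      have : dist w (m δ • w) = dist (σ • w) (δ • σ • w) := by
        rw [smul_eq_repr, ← dist_smul σ w, ← mul_smul, ← mul_smul, hm]
        congr 2
        group
      rw [this]
      exact hs δ hδ
    have h2 := Real.cosh_le_cosh.mpr (abs_le_abs_of_nonneg dist_nonneg h1)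
    have h3 := h2.trans (Real.cosh_le_exp_half_sq R)
    have h4 : Real.exp (R ^ 2 / 2) ≤ 1 + R ^ 2 := by
      have h5 : |R ^ 2 / 2| ≤ 1 := by
        rw [abs_of_nonneg (by positivity)]
        nlinarith
      have h6 := Real.abs_exp_sub_one_le h5
      rw [abs_of_nonneg (show (0 : ℝ) ≤ R ^ 2 / 2 by positivity)] at h6
      have := (abs_le.mp h6).2
      linarith
    rw [cosh_dist_smul, a1, a2] at h3
    have h7 : (m δ 0 1) ^ 2 / (2 * w.im ^ 2) ≤ R ^ 2 := by
      have := h3.trans h4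
      simp only [zero_mul, sub_self, zero_add, mul_zero, zero_sub, neg_sq, add_zero] at this
      have e : ((m δ 0 1) ^ 2 + (0 : ℝ) ^ 2) / (2 * w.im ^ 2) = (m δ 0 1) ^ 2 / (2 * w.im ^ 2) := by
        simp
      linarith
    rw [div_le_iff₀ (by positivity)] at h7
    refine abs_le_of_sq_le_sq ?_ hL0
    rw [mul_pow, a3, hL]
    nlinarith [sq_nonneg (w.im * R)]
  -- The quotient of two such elements is again a translation, and by minimality it is no shorter
  -- than the unit translation `γ`. Distinct lengths in `[-L, L]` thus have distinct floors, which
  -- leaves at most `2 * L + 2` of them.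
  have hsep : ∀ δ ∈ s, ∀ ε ∈ s, δ ≠ ε → 1 ≤ |m δ 0 0 * m δ 0 1 - m ε 0 0 * m ε 0 1| := by
    intro δ hδ ε hε hne
    obtain ⟨a1, a2, a3⟩ := hup δ hδ
    obtain ⟨b1, b2, b3⟩ := hup ε hε
    obtain ⟨n1, n2⟩ := repr_ne hne
    have hle := hγ.le _ ((slLift Γ).mul_mem ((slLift Γ).inv_mem (repr_mem δ)) (repr_mem ε)) n1 n2
    have hconj : σ⁻¹ * ((repr δ)⁻¹ * repr ε) * σ = (m δ)⁻¹ * m ε := by rw [hm]; group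
    obtain ⟨i1, i2, i3, i4⟩ := sl_inv_entries (m δ)
    have e10 : ((m δ)⁻¹ * m ε) 1 0 = 0 := by
      simp [sl_mul_apply, i1, i2, i3, i4, a1, b1]
    have e00 : ((m δ)⁻¹ * m ε) 0 0 = ((m δ)⁻¹ * m ε) 1 1 := by
      simp only [sl_mul_apply, i1, i2, i3, i4, a1, b1, a2, b2]
      ring
    have e01 : ((m δ)⁻¹ * m ε) 0 1 = m δ 0 0 * m ε 0 1 - m ε 0 0 * m δ 0 1 := by
      simp only [sl_mul_apply, i1, i2, i3, i4, a1, b1, a2, b2]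
      ring
    rw [tnorm_smul, tnorm_smul, hconj, tnorm_of_upper h10 he, h01, tnorm_of_upper e10 e00, e01,
      div_le_div_iff_of_pos_right (by positivity)] at hle
    rw [← sq_abs, one_le_sq_iff_one_le_abs, abs_abs] at hle
    have h5 : (m δ 0 0 * m δ 0 1 - m ε 0 0 * m ε 0 1) ^ 2 =
        (m δ 0 0 * m ε 0 1 - m ε 0 0 * m δ 0 1) ^ 2 := by
      linear_combination (m δ 0 1 ^ 2 - m ε 0 1 ^ 2) * a3 + (m ε 0 1 ^ 2 - m δ 0 1 ^ 2) * b3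
    rw [← one_le_sq_iff_one_le_abs] at hle ⊢
    rw [h5]
    exact hle
  have hinj : Set.InjOn (fun δ ↦ ⌊m δ 0 0 * m δ 0 1⌋) s := by
    intro δ hδ ε hε h
    by_contra hne
    exact absurd (Int.abs_sub_lt_one_of_floor_eq_floor h) (not_lt.mpr (hsep δ hδ ε hε hne))
  have hcard := Finset.card_le_card_of_injOn (t := Finset.Icc ⌊-L⌋ ⌊L⌋) _ (fun δ hδ ↦ by
    have := abs_le.mp (hbound δ hδ)
    exact Finset.mem_coe.mpr (Finset.mem_Icc.mpr
      ⟨Int.floor_mono this.1, Int.floor_mono this.2⟩)) hinj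
  rw [Int.card_Icc] at hcard
  have h1 : ⌊-L⌋ ≤ ⌊L⌋ := Int.floor_mono (by linarith)
  have h2 : (s.card : ℤ) ≤ ⌊L⌋ + 1 - ⌊-L⌋ := by
    have := Int.toNat_of_nonneg (show 0 ≤ ⌊L⌋ + 1 - ⌊-L⌋ by linarith)
    omega
  have h3 : (s.card : ℝ) ≤ ⌊L⌋ + 1 - ⌊-L⌋ := by exact_mod_cast h2
  have h4 := Int.floor_le L
  have h5 := Int.lt_floor_add_one (-L)
  rw [hL] at *
  linarith

end

/-! ### Sub-mean value inequality and the local estimate for the density. -/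

section

/-- The value at the centre of a disc of the square of a holomorphic function is at most the mean
over a circle. -/
theorem sq_norm_le_circleAverage {g : ℂ → ℂ} {c : ℂ} {r : ℝ}
    (hg : DifferentiableOn ℂ g (Metric.closedBall c |r|)) :
    ‖g c‖ ^ 2 ≤ Real.circleAverage (fun z ↦ ‖g z‖ ^ 2) c r := by
  have h1 : DiffContOnCl ℂ (fun z ↦ g z ^ 2) (Metric.ball c |r|) :=
    (hg.pow 2).diffContOnCl_ball subset_rfl
  have h2 := h1.circleAverage
  rw [← norm_pow, ← h2, Real.circleAverage_def, Real.circleAverage_def, norm_smul, smul_eq_mul,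
    Real.norm_of_nonneg (by positivity)]
  gcongr
  refine (intervalIntegral.norm_integral_le_integral_norm Real.two_pi_pos.le).trans_eq ?_
  simp [norm_pow]

theorem lintegral_circle_ge {g : ℂ → ℂ} {c : ℂ} {r : ℝ} (hr : 0 < r)
    (hg : DifferentiableOn ℂ g (Metric.closedBall c r)) :
    ENNReal.ofReal (2 * Real.pi * ‖g c‖ ^ 2) ≤
      ∫⁻ θ in Set.Ioo (-Real.pi) Real.pi, ENNReal.ofReal (‖g (circleMap c r θ)‖ ^ 2) := by
  have h1 := sq_norm_le_circleAverage (g := g) (c := c) (r := r) (by rwa [abs_of_pos hr])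
  rw [Real.circleAverage_eq_integral_add (-Real.pi),
    intervalIntegral.integral_comp_add_right (fun θ ↦ ‖g (circleMap c r θ)‖ ^ 2), smul_eq_mul,
    zero_add, show 2 * Real.pi + -Real.pi = Real.pi by ring,
    intervalIntegral.integral_of_le (by linarith [Real.pi_pos]), integral_Ioc_eq_integral_Ioo] at h1
  have hcont : Continuous fun θ ↦ ‖g (circleMap c r θ)‖ ^ 2 := by
    have : Continuous fun θ ↦ g (circleMap c r θ) :=
      hg.continuousOn.comp_continuous (continuous_circleMap c r)
        fun θ ↦ Metric.sphere_subset_closedBall (circleMap_mem_sphere c hr.le θ)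
    exact this.norm.pow 2
  rw [← ofReal_integral_eq_lintegral_ofReal]
  · apply ENNReal.ofReal_le_ofReal
    rw [inv_mul_eq_div, le_div_iff₀ (by positivity)] at h1
    linarith
  · exact (hcont.integrableOn_Icc (a := -Real.pi) (b := Real.pi)).mono_set Set.Ioo_subset_Icc_self
  · exact Filter.Eventually.of_forall fun θ ↦ by positivity

/-- The sub-mean value inequality on discs for the square of a holomorphic function. -/
theorem sq_norm_mul_le_lintegral_ball {g : ℂ → ℂ} {c : ℂ} {R : ℝ} (hR : 0 < R)
    (hg : DifferentiableOn ℂ g (Metric.ball c R)) :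
    ENNReal.ofReal (Real.pi * R ^ 2 * ‖g c‖ ^ 2) ≤
      ∫⁻ z in Metric.ball c R, ENNReal.ofReal (‖g z‖ ^ 2) := by
  set F : ℂ → ENNReal := (Metric.ball c R).indicator fun z ↦ ENNReal.ofReal (‖g z‖ ^ 2) with hF
  have hFm : Measurable F := by
    classical
    rw [hF, ← Set.piecewise_eq_indicator]
    refine ContinuousOn.measurable_piecewise ?_ continuousOn_const Metric.isOpen_ball.measurableSet
    exact ENNReal.continuous_ofReal.comp_continuousOn (hg.continuousOn.norm.pow 2)
  have hpolar : Measurable fun p : ℝ × ℝ ↦ F (c + Complex.polarCoord.symm p) := by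
    refine hFm.comp ?_
    simp only [Complex.polarCoord_symm_apply]
    fun_prop
  rw [← lintegral_indicator Metric.isOpen_ball.measurableSet, ← hF,
    ← lintegral_add_left_eq_self F c, ← Complex.lintegral_comp_polarCoord_symm,
    polarCoord_target, Measure.volume_eq_prod, ← Measure.prod_restrict, lintegral_prod]
  · have h1 : ∀ r ∈ Set.Ioo 0 R, ENNReal.ofReal (2 * Real.pi * ‖g c‖ ^ 2 * r) ≤
        ∫⁻ θ in Set.Ioo (-Real.pi) Real.pi,
          ENNReal.ofReal r • F (c + Complex.polarCoord.symm (r, θ)) := by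
      rintro r ⟨hr0, hrR⟩
      have h2 := lintegral_circle_ge hr0 (hg.mono (Metric.closedBall_subset_ball hrR))
      have h3 : ∀ θ : ℝ, F (c + Complex.polarCoord.symm (r, θ)) =
          ENNReal.ofReal (‖g (circleMap c r θ)‖ ^ 2) := by
        intro θ
        have e : c + Complex.polarCoord.symm (r, θ) = circleMap c r θ := by
          rw [Complex.polarCoord_symm_apply, circleMap, Complex.exp_mul_I]
          simp
        rw [e, hF, Set.indicator_of_mem]
        exact Metric.closedBall_subset_ball hrR
          (Metric.sphere_subset_closedBall (circleMap_mem_sphere c hr0.le θ))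
      simp only [smul_eq_mul]
      rw [lintegral_const_mul' _ _ ENNReal.ofReal_ne_top]
      simp only [h3]
      rw [mul_comm, ENNReal.ofReal_mul hr0.le]
      gcongr
    calc ENNReal.ofReal (Real.pi * R ^ 2 * ‖g c‖ ^ 2)
        = ∫⁻ r in Set.Ioo 0 R, ENNReal.ofReal (2 * Real.pi * ‖g c‖ ^ 2 * r) := by
          rw [← ofReal_integral_eq_lintegral_ofReal]
          · rw [integral_const_mul, ← integral_Ioc_eq_integral_Ioo,
              ← intervalIntegral.integral_of_le hR.le, integral_id]
            congr 1
            ring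
          · exact ((continuous_const.mul continuous_id).integrableOn_Icc (a := 0) (b := R)).mono_set
              Set.Ioo_subset_Icc_self
          · refine (ae_restrict_iff' measurableSet_Ioo).mpr
              (Filter.Eventually.of_forall fun r hr ↦ ?_)
            have := hr.1
            simp only [Pi.zero_apply]
            positivity
      _ ≤ ∫⁻ r in Set.Ioo 0 R, ∫⁻ θ in Set.Ioo (-Real.pi) Real.pi,
            ENNReal.ofReal r • F (c + Complex.polarCoord.symm (r, θ)) :=
          setLIntegral_mono' measurableSet_Ioo h1
      _ ≤ _ := lintegral_mono_set fun r hr ↦ hr.1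
  · refine Measurable.aemeasurable ?_
    simp only [smul_eq_mul]
    exact (ENNReal.measurable_ofReal.comp measurable_fst).mul hpolar

/-- Integrals for the hyperbolic measure as integrals over the complex plane. -/
theorem setLIntegral_hyperbolic {φ : ℍ → ENNReal} (hφ : Measurable φ) {S : Set ℍ}
    (hS : MeasurableSet S) : ∫⁻ z in S, φ z =
      ∫⁻ ζ in UpperHalfPlane.coe '' S, ENNReal.ofReal (1 / ζ.im ^ 2) * φ (ofComplex ζ) := by
  have hmp : MeasurePreserving UpperHalfPlane.coe (volume.comap UpperHalfPlane.coe)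
      (volume.restrict (.range UpperHalfPlane.coe)) :=
    ⟨measurable_coe, by rw [measurableEmbedding_coe.map_comap]⟩
  have hm : Measurable fun z : ℍ ↦ (((1 / NNReal.mk z.im z.im_pos.le : NNReal) ^ 2 : NNReal) : ENNReal) := by
    have : Continuous fun z : ℍ ↦ (NNReal.mk z.im z.im_pos.le : NNReal) :=
      continuous_im.subtype_mk _
    have h2 := this.measurable
    fun_prop
  rw [volume_def, setLIntegral_withDensity_eq_setLIntegral_mul _ hm hφ hS]
  have h1 := hmp.setLIntegral_comp_emb measurableEmbedding_coe
    (fun ζ ↦ ENNReal.ofReal (1 / ζ.im ^ 2) * φ (ofComplex ζ)) S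
  rw [Measure.restrict_restrict_of_subset (Set.image_subset_range _ _)] at h1
  rw [← h1]
  refine setLIntegral_congr_fun hS fun z _ ↦ ?_
  simp only [Pi.mul_apply, ofComplex_apply]
  congr 1
  rw [← ENNReal.ofReal_coe_nnreal]
  congr 1
  simp

variable {Γ : Subgroup PSL(2, ℝ)} {k : ℕ}

/-- The `Γ`-invariant function `|f z| ^ 2 (Im z) ^ (2 k)`. -/
def density (k : ℕ) (f : ℍ → ℂ) (z : ℍ) : ℝ := ‖f z‖ ^ 2 * z.im ^ (2 * k)

theorem density_nonneg (k : ℕ) (f : ℍ → ℂ) (z : ℍ) : 0 ≤ density k f z := by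
  have := z.im_pos
  unfold density
  positivity

theorem density_eq_norm_petersson (k : ℕ) (f : ℍ → ℂ) (z : ℍ) :
    density k f z = ‖petersson (2 * (k : ℤ)) f f z‖ := by
  have := z.im_pos
  rw [density, petersson, norm_mul, norm_mul, norm_zpow, Complex.norm_conj, Complex.norm_real,
    Real.norm_of_nonneg this.le, sq]
  norm_cast

theorem density_slash (k : ℕ) (f : ℍ → ℂ) (σ : SL(2, ℝ)) (z : ℍ) :
    density k (SlashAction.map (2 * (k : ℤ)) (σ : GL (Fin 2) ℝ) f) z = density k f (σ • z) := by
  rw [density_eq_norm_petersson, density_eq_norm_petersson, petersson_slash]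
  simp
  rfl

theorem toGL_mem_matrixLift {g : SL(2, ℝ)} (hg : g ∈ slLift Γ) :
    (g : GL (Fin 2) ℝ) ∈ matrixLift Γ := ⟨g, hg, rfl⟩

theorem density_smul_of_mem (f : CuspForms Γ k) {g : SL(2, ℝ)} (hg : g ∈ slLift Γ) (z : ℍ) :
    density k f (g • z) = density k f z := by
  rw [← density_slash, SlashInvariantFormClass.slash_action_eq f _ (toGL_mem_matrixLift hg)]

theorem density_smul (f : CuspForms Γ k) (γ : Γ) (z : ℍ) :
    density k f (γ • z) = density k f z := by
  rw [smul_eq_repr, density_smul_of_mem f (repr_mem γ)]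

theorem continuous_density {f : ℍ → ℂ} (hf : Continuous f) : Continuous (density k f) := by
  unfold density
  have := UpperHalfPlane.continuous_im
  fun_prop

theorem measurable_ofReal_density {f : ℍ → ℂ} (hf : Continuous f) :
    Measurable fun z ↦ ENNReal.ofReal (density k f z) :=
  ENNReal.measurable_ofReal.comp (continuous_density hf).measurable

theorem exp_le_one_add {t : ℝ} (h1 : -(1 / 5) ≤ t) (h2 : t ≤ 1 / 5) :
    Real.exp (t - 2 * t ^ 2) ≤ 1 + t := by
  have h3 : |t - 2 * t ^ 2| ≤ 1 := by
    rw [abs_le]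
    constructor <;> nlinarith
  have h4 := (abs_le.mp (Real.abs_exp_sub_one_sub_id_le h3)).2
  have h5 : 0 ≤ t ^ 2 * (1 + 4 * t - 4 * t ^ 2) := by
    apply mul_nonneg (sq_nonneg _)
    nlinarith
  nlinarith

/-- On a disc of relative radius `1 / (5 * √k)` the weight `(1 + t) ^ (2 * k)` agrees with its
linearisation `exp (2 * k * t)` up to a constant: the quadratic error `4 * k * t ^ 2` in the
exponent is at most `4/25`. -/
theorem pow_div_sq_ge (hk : 1 ≤ k) {t : ℝ} (ht : t ^ 2 ≤ 1 / (25 * k)) :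
    Real.exp (2 * k * t) / 2 ≤ (1 + t) ^ (2 * k) / (1 + t) ^ 2 := by
  have hk' : (1 : ℝ) ≤ k := by exact_mod_cast hk
  have ht' : t ^ 2 ≤ (1 / 5) ^ 2 := by
    refine ht.trans ?_
    rw [div_le_iff₀ (by positivity)]
    linarith
  obtain ⟨h1, h2⟩ := abs_le.mp (abs_le_of_sq_le_sq ht' (by norm_num))
  have h3 := exp_le_one_add h1 h2
  have h4 : Real.exp (2 * k * t) * Real.exp (-(4 / 25)) ≤ (1 + t) ^ (2 * k) := by
    calc _ = Real.exp (2 * k * t + -(4 / 25)) := (Real.exp_add _ _).symm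
      _ ≤ Real.exp ((2 * k : ℕ) * (t - 2 * t ^ 2)) := by
          apply Real.exp_le_exp.mpr
          rw [le_div_iff₀ (by positivity)] at ht
          push_cast
          linarith
      _ = Real.exp (t - 2 * t ^ 2) ^ (2 * k) := Real.exp_nat_mul _ _
      _ ≤ _ := by gcongr
  have h5 : (1 : ℝ) - 4 / 25 ≤ Real.exp (-(4 / 25)) := by
    have := Real.add_one_le_exp (-(4 / 25) : ℝ)
    linarith
  have h6 := Real.exp_pos (2 * k * t)
  have h7 : (1 + t) ^ 2 ≤ 36 / 25 := by nlinarith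
  rw [le_div_iff₀ (by nlinarith)]
  calc Real.exp (2 * k * t) / 2 * (1 + t) ^ 2 ≤ Real.exp (2 * k * t) / 2 * (36 / 25) := by gcongr
    _ ≤ Real.exp (2 * k * t) * Real.exp (-(4 / 25)) := by nlinarith
    _ ≤ _ := h4

/-- Local estimate for the density of a holomorphic function in terms of its mean over a disc of
radius comparable to `k ^ (-1/2)`. -/
theorem density_le_setLIntegral (hk : 1 ≤ k) {f : ℍ → ℂ} (hf : MDiff f) (z : ℍ) :
    ENNReal.ofReal (density k f z) ≤ ENNReal.ofReal (25 * k) *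
      ∫⁻ w in UpperHalfPlane.coe ⁻¹' Metric.ball (z : ℂ) (z.im / (5 * √k)),
        ENNReal.ofReal (density k f w) := by
  have hk' : (1 : ℝ) ≤ k := by exact_mod_cast hk
  have hy := z.im_pos
  set ρ := z.im / (5 * √k) with hρ
  have hsk : 1 ≤ √(k : ℝ) := Real.one_le_sqrt.mpr hk'
  have hsk2 : √(k : ℝ) ^ 2 = k := Real.sq_sqrt (by positivity)
  have hρpos : 0 < ρ := by positivity
  have hρz : ρ < z.im := by
    rw [hρ, div_lt_iff₀ (by positivity)]
    nlinarith
  have hρ2 : ρ ^ 2 = z.im ^ 2 * (1 / (25 * k)) := by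
    rw [hρ, div_pow, mul_pow, hsk2]
    ring
  set B := Metric.ball (z : ℂ) ρ with hB
  have himB : ∀ ζ ∈ B, (ζ.im - z.im) ^ 2 ≤ ρ ^ 2 := by
    intro ζ hζ
    rw [sq_le_sq, abs_of_pos hρpos]
    have h1 := Complex.abs_im_le_norm (ζ - z)
    rw [hB, Metric.mem_ball, Complex.dist_eq] at hζ
    simp only [Complex.sub_im, coe_im] at h1
    exact h1.trans hζ.le
  have hpos : ∀ ζ ∈ B, 0 < ζ.im := by
    intro ζ hζ
    have := abs_le.mp (abs_le_of_sq_le_sq (himB ζ hζ) hρpos.le)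
    linarith [this.1]
  have himage : UpperHalfPlane.coe '' (UpperHalfPlane.coe ⁻¹' B) = B := by
    rw [Set.image_preimage_eq_iff]
    intro ζ hζ
    exact ⟨⟨ζ, hpos ζ hζ⟩, rfl⟩
  rw [setLIntegral_hyperbolic (measurable_ofReal_density hf.continuous)
    (Metric.isOpen_ball.measurableSet.preimage measurable_coe), himage]
  -- The holomorphic twist has squared modulus `exp (2 * k * t)` with `t = (ζ.im - z.im) / z.im`, so
  -- `‖g‖ ^ 2` imitates the density while the mean value inequality still applies.
  set g : ℂ → ℂ := fun ζ ↦ f (ofComplex ζ) *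
    Complex.exp (-(Complex.I * (k / z.im : ℝ)) * (ζ - z)) with hg
  have hgd : DifferentiableOn ℂ g B := by
    refine DifferentiableOn.mul ?_ ?_
    · exact (UpperHalfPlane.mdifferentiable_iff.mp hf).mono fun ζ hζ ↦ hpos ζ hζ
    · fun_prop
  have hgz : g z = f z := by simp [hg]
  have hgn : ∀ ζ, ‖g ζ‖ ^ 2 = ‖f (ofComplex ζ)‖ ^ 2 *
      Real.exp (2 * k * ((ζ.im - z.im) / z.im)) := by
    intro ζ
    rw [hg, norm_mul, mul_pow, Complex.norm_exp, ← Real.exp_nat_mul]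
    congr 2
    simp
    ring
  have hmv := sq_norm_mul_le_lintegral_ball hρpos hgd
  rw [hgz] at hmv
  have hpt : ∀ ζ ∈ B, ENNReal.ofReal (z.im ^ (2 * k) / (2 * z.im ^ 2)) *
      ENNReal.ofReal (‖g ζ‖ ^ 2) ≤
        ENNReal.ofReal (1 / ζ.im ^ 2) * ENNReal.ofReal (density k f (ofComplex ζ)) := by
    intro ζ hζ
    rw [← ENNReal.ofReal_mul (by positivity), ← ENNReal.ofReal_mul (by positivity)]
    apply ENNReal.ofReal_le_ofReal
    have hζp := hpos ζ hζ
    rw [density, hgn, ofComplex_apply_of_im_pos hζp]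
    change _ ≤ 1 / ζ.im ^ 2 * (_ * ζ.im ^ (2 * k))
    set t := (ζ.im - z.im) / z.im with ht
    have hzt : ζ.im = z.im * (1 + t) := by rw [ht]; field_simp; ring
    have ht2 : t ^ 2 ≤ 1 / (25 * k) := by
      rw [ht, div_pow, div_le_iff₀ (by positivity)]
      linarith [himB ζ hζ]
    have hmain := pow_div_sq_ge hk ht2
    rw [hzt]
    set A := ‖f ⟨ζ, hζp⟩‖ ^ 2 with hA
    have hA0 : 0 ≤ A := by positivity
    calc z.im ^ (2 * k) / (2 * z.im ^ 2) * (A * Real.exp (2 * k * t))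
        = z.im ^ (2 * k) / z.im ^ 2 * A * (Real.exp (2 * k * t) / 2) := by field_simp
      _ ≤ z.im ^ (2 * k) / z.im ^ 2 * A * ((1 + t) ^ (2 * k) / (1 + t) ^ 2) := by gcongr
      _ = _ := by rw [mul_pow, mul_pow]; field_simp
  have hint : ENNReal.ofReal (z.im ^ (2 * k) / (2 * z.im ^ 2)) *
      ENNReal.ofReal (Real.pi * ρ ^ 2 * ‖f z‖ ^ 2) ≤
        ∫⁻ ζ in B, ENNReal.ofReal (1 / ζ.im ^ 2) *
          ENNReal.ofReal (density k f (ofComplex ζ)) := by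
    refine le_trans ?_ (setLIntegral_mono' Metric.isOpen_ball.measurableSet hpt)
    rw [lintegral_const_mul' _ _ ENNReal.ofReal_ne_top]
    gcongr
  refine le_trans ?_ (mul_le_mul_right hint _)
  rw [← ENNReal.ofReal_mul (by positivity), ← ENNReal.ofReal_mul (by positivity)]
  apply ENNReal.ofReal_le_ofReal
  rw [hρ2, density]
  have hpi := Real.pi_gt_three
  have e : 25 * (k : ℝ) * (z.im ^ (2 * k) / (2 * z.im ^ 2) *
      (Real.pi * (z.im ^ 2 * (1 / (25 * k))) * ‖f z‖ ^ 2)) =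
      (‖f z‖ ^ 2 * z.im ^ (2 * k)) * (Real.pi / 2) := by
    field_simp
  rw [e]
  refine le_mul_of_one_le_right (by positivity) (by linarith)

/-- The estimate of the density at a point by the integral over a fundamental domain. -/
theorem density_le_of_displacementBound [Countable Γ] {F : Set ℍ}
    (hF : IsFundamentalDomain Γ F (volume : Measure ℍ)) (hk : 1 ≤ k) (f : CuspForms Γ k)
    {z : ℍ} {N : ℝ} (hN : DisplacementBound Γ z (1 / √k) N) :
    ENNReal.ofReal (density k f z) ≤
      ENNReal.ofReal (25 * k * N) * ∫⁻ w in F, ENNReal.ofReal (density k f w) := by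
  have hk' : (1 : ℝ) ≤ k := by exact_mod_cast hk
  have hy := z.im_pos
  have hsk : 1 ≤ √(k : ℝ) := Real.one_le_sqrt.mpr hk'
  refine (density_le_setLIntegral hk (CuspFormClass.holo f) z).trans ?_
  rw [ENNReal.ofReal_mul (show (0 : ℝ) ≤ 25 * k by positivity), mul_assoc]
  gcongr
  refine setLIntegral_le_of_multiplicityBound hF
    (Metric.isOpen_ball.measurableSet.preimage measurable_coe) ?_
    (measurable_ofReal_density (CuspFormClass.holo f).continuous)
    (fun γ w ↦ by rw [density_smul])
  -- Heights on the Euclidean disc are at least `4/5 * z.im`, so hyperbolic distances to `z` are at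
  -- most `1 / (4 * √k)`, below `r`. The doubled radius is the displacement `1 / √k` of the
  -- hypothesis.
  refine multiplicityBound_of_subset_ball (w := z) (r := 1 / (2 * √k)) ?_ ?_
  · intro w hw
    have hw' : dist (w : ℂ) z < z.im / (5 * √k) := hw
    rw [Metric.mem_ball]
    refine (dist_le_dist_coe_div_sqrt w z).trans_lt ?_
    have h1 : z.im / (5 * √k) ≤ z.im / 5 := by
      apply div_le_div_of_nonneg_left hy.le (by norm_num) (by linarith)
    have h2 := Complex.abs_im_le_norm ((w : ℂ) - z)
    rw [← Complex.dist_eq] at h2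
    simp only [Complex.sub_im, coe_im] at h2
    have h3 : z.im * (4 / 5) ≤ w.im := by
      have := (abs_le.mp (h2.trans hw'.le)).1
      linarith
    have h4 : z.im * (4 / 5) ≤ √(w.im * z.im) := by
      apply Real.le_sqrt_of_sq_le
      nlinarith
    rw [div_lt_iff₀ (by linarith)]
    calc _ < z.im / (5 * √k) := hw'
      _ ≤ 1 / (2 * √k) * (z.im * (4 / 5)) := by
        rw [div_le_iff₀ (by positivity)]
        field_simp
        norm_num
      _ ≤ _ := by gcongr
  · convert hN using 1
    field_simp

end

/-! ### Behaviour in the cusps and the sup-norm bound for one form. -/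

section

/-- Maximum principle at a cusp: a periodic function vanishing at infinity decays exponentially from
its values on a horizontal line. -/
theorem norm_le_mul_exp_of_periodic {h : ℍ → ℂ}
    (hper : Function.Periodic (h ∘ ofComplex) ((1 : ℝ) : ℂ)) (hol : MDiff h)
    (hzero : IsZeroAtImInfty h) {y₀ A : ℝ} (hy₀ : 0 < y₀) (hA : ∀ z : ℍ, z.im = y₀ → ‖h z‖ ≤ A)
    {z : ℍ} (hz : y₀ ≤ z.im) : ‖h z‖ ≤ A * Real.exp (-(2 * Real.pi * (z.im - y₀))) := by
  have hpi := Real.pi_pos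
  have hbdd : IsBoundedAtImInfty h := hzero.isBoundedAtImInfty
  set G := cuspFunction 1 h with hG
  have hGd : DifferentiableOn ℂ G (Metric.ball 0 1) :=
    differentiableOn_cuspFunction_ball one_pos hper hol hbdd
  -- As in the Schwarz lemma, `G q / q` is holomorphic across `0`, and the maximum principle bounds
  -- it by its values on the circle corresponding to height `y₀`.
  have hG0 : G 0 = 0 := hzero.cuspFunction_apply_zero one_pos
  have hDd : DifferentiableOn ℂ (dslope G 0) (Metric.ball 0 1) :=
    (Complex.differentiableOn_dslope (Metric.ball_mem_nhds 0 one_pos)).mpr hGd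
  set R := Real.exp (-(2 * Real.pi * y₀)) with hR
  have hRpos : 0 < R := Real.exp_pos _
  have hR1 : R < 1 := by
    rw [hR, Real.exp_lt_one_iff]
    have : 0 < 2 * Real.pi * y₀ := by positivity
    linarith
  have hslope : ∀ q : ℂ, q ≠ 0 → ‖dslope G 0 q‖ = ‖G q‖ / ‖q‖ := by
    intro q hq
    rw [dslope_of_ne _ hq, slope_def_field, hG0, sub_zero, sub_zero, norm_div]
  have hbound : ∀ q ∈ Metric.closedBall (0 : ℂ) R, ‖dslope G 0 q‖ ≤ A / R := by
    intro q hq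
    rw [← closure_ball (0 : ℂ) hRpos.ne'] at hq
    refine Complex.norm_le_of_forall_mem_frontier_norm_le Metric.isBounded_ball
      (hDd.diffContOnCl_ball (Metric.closedBall_subset_ball hR1)) ?_ hq
    intro p hp
    rw [frontier_ball _ hRpos.ne', mem_sphere_zero_iff_norm] at hp
    have hp0 : p ≠ 0 := by
      rw [← norm_ne_zero_iff, hp]
      exact hRpos.ne'
    have him : (Function.Periodic.invQParam 1 p).im = y₀ := by
      rw [Function.Periodic.im_invQParam, hp, hR, Real.log_exp]
      field_simp
    have hGp : G p = h ⟨Function.Periodic.invQParam 1 p, him ▸ hy₀⟩ := by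
      rw [hG, ← eq_cuspFunction _ one_ne_zero hper]
      congr 1
      exact (Function.Periodic.qParam_right_inv one_ne_zero hp0).symm
    rw [hslope p hp0, hp]
    gcongr
    rw [hGp]
    exact hA _ him
  have hq : ‖Function.Periodic.qParam 1 z‖ = Real.exp (-(2 * Real.pi * z.im)) := by
    rw [Function.Periodic.norm_qParam]
    congr 1
    simp
  have hq0 : Function.Periodic.qParam 1 (z : ℂ) ≠ 0 := Function.Periodic.qParam_ne_zero _
  have h1 := hbound (Function.Periodic.qParam 1 z) (by
    rw [mem_closedBall_zero_iff, hq, hR]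
    apply Real.exp_le_exp.mpr
    have : 2 * Real.pi * y₀ ≤ 2 * Real.pi * z.im := by gcongr
    linarith)
  rw [hslope _ hq0, hG, eq_cuspFunction z one_ne_zero hper, hq,
    div_le_iff₀ (Real.exp_pos _)] at h1
  refine h1.trans_eq ?_
  rw [hR, div_mul_eq_mul_div, mul_div_assoc, ← Real.exp_sub]
  congr 2
  ring

/-- The cusp form decays like `exp (-2πy)` while the weight grows like `y ^ k`. Their product
decreases once `y ≥ k / (2π)`, in particular beyond `y₀ ≥ k`. -/
theorem density_le_of_height {k : ℕ} {h : ℍ → ℂ}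
    (hper : Function.Periodic (h ∘ ofComplex) ((1 : ℝ) : ℂ)) (hol : MDiff h)
    (hzero : IsZeroAtImInfty h) {y₀ B : ℝ} (hy₀ : 0 < y₀) (hk : k ≤ y₀)
    (hB : ∀ z : ℍ, z.im = y₀ → density k h z ≤ B) {z : ℍ} (hz : y₀ ≤ z.im) :
    density k h z ≤ B := by
  have hB0 : 0 ≤ B := (density_nonneg k h ⟨⟨0, y₀⟩, hy₀⟩).trans (hB _ rfl)
  have hA : ∀ z : ℍ, z.im = y₀ → ‖h z‖ ≤ √B / y₀ ^ k := by
    intro w hw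
    rw [le_div_iff₀ (by positivity)]
    apply Real.le_sqrt_of_sq_le
    refine le_trans (le_of_eq ?_) (hB w hw)
    rw [density, hw]
    ring
  have h1 := norm_le_mul_exp_of_periodic hper hol hzero hy₀ hA hz
  have hzpos := z.im_pos
  have h2 : z.im ^ k ≤ y₀ ^ k * Real.exp (2 * Real.pi * (z.im - y₀)) := by
    have h3 : z.im / y₀ ≤ Real.exp (z.im / y₀ - 1) := by
      have := Real.add_one_le_exp (z.im / y₀ - 1)
      linarith
    have h4 : (z.im / y₀) ^ k ≤ Real.exp (k * (z.im / y₀ - 1)) := by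
      rw [Real.exp_nat_mul]
      gcongr
    have h5 : (k : ℝ) * (z.im / y₀ - 1) ≤ 2 * Real.pi * (z.im - y₀) := by
      have e : z.im / y₀ - 1 = (z.im - y₀) / y₀ := by field_simp
      have h6 : (k : ℝ) * (z.im / y₀ - 1) ≤ z.im - y₀ := by
        rw [e, mul_div_assoc', div_le_iff₀ hy₀, mul_comm]
        exact mul_le_mul_of_nonneg_left hk (by linarith)
      have h7 := Real.pi_gt_three
      nlinarith
    have h8 := h4.trans (Real.exp_le_exp.mpr h5)
    rw [div_pow, div_le_iff₀ (by positivity)] at h8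
    linarith
  have h3 : ‖h z‖ * z.im ^ k ≤ √B := by
    calc ‖h z‖ * z.im ^ k ≤ √B / y₀ ^ k * Real.exp (-(2 * Real.pi * (z.im - y₀))) *
        (y₀ ^ k * Real.exp (2 * Real.pi * (z.im - y₀))) := by gcongr
      _ = √B * (Real.exp (-(2 * Real.pi * (z.im - y₀))) *
          Real.exp (2 * Real.pi * (z.im - y₀))) := by field_simp
      _ = √B := by rw [← Real.exp_add]; simp
  calc density k h z = (‖h z‖ * z.im ^ k) ^ 2 := by rw [density]; ring
    _ ≤ √B ^ 2 := by gcongr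
    _ = B := Real.sq_sqrt hB0

variable {Γ : Subgroup PSL(2, ℝ)} {k : ℕ}

/-- `σ` maps a neighbourhood of infinity to a neighbourhood of a cusp of `Γ`, in which `γ` is
conjugate to a translation by `1`. -/
structure IsCuspChart (Γ : Subgroup PSL(2, ℝ)) (γ σ : SL(2, ℝ)) : Prop where
  mem : γ ∈ slLift Γ
  lower : (σ⁻¹ * γ * σ) 1 0 = 0
  diag : (σ⁻¹ * γ * σ) 0 0 = (σ⁻¹ * γ * σ) 1 1
  upper : ((σ⁻¹ * γ * σ) 0 1) ^ 2 = 1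

theorem IsCuspChart.tnorm {γ σ : SL(2, ℝ)} (hc : IsCuspChart Γ γ σ) (w : ℍ) :
    tnorm γ (σ • w) = 1 / w.im ^ 2 := by
  rw [tnorm_smul, tnorm_of_upper hc.lower hc.diag, hc.upper]

theorem IsCuspChart.isCusp {γ σ : SL(2, ℝ)} (hc : IsCuspChart Γ γ σ) :
    IsCusp ((σ : GL (Fin 2) ℝ) • OnePoint.infty) (matrixLift Γ) := by
  have e : (γ : GL (Fin 2) ℝ) = (σ : GL (Fin 2) ℝ) * ((σ⁻¹ * γ * σ : SL(2, ℝ)) : GL (Fin 2) ℝ) *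
      (σ : GL (Fin 2) ℝ)⁻¹ := by
    simp only [map_mul, map_inv]
    group
  have h10 : ((σ⁻¹ * γ * σ : SL(2, ℝ)) : GL (Fin 2) ℝ) 1 0 = 0 := hc.lower
  refine ⟨γ, toGL_mem_matrixLift hc.mem, ?_, ?_⟩
  · rw [e, Matrix.GeneralLinearGroup.isParabolic_conj_iff,
      Matrix.GeneralLinearGroup.isParabolic_iff_of_upperTriangular h10]
    refine ⟨hc.diag, fun h ↦ ?_⟩
    have h' : (σ⁻¹ * γ * σ) 0 1 = 0 := h
    have := hc.upper
    rw [h'] at this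
    norm_num at this
  · rw [e, mul_smul, mul_smul, inv_smul_smul, OnePoint.smul_infty_eq_self_iff.mpr h10]

theorem IsCuspChart.periodic {γ σ : SL(2, ℝ)} (hc : IsCuspChart Γ γ σ) (f : CuspForms Γ k) :
    Function.Periodic ((SlashAction.map (2 * (k : ℤ)) (σ : GL (Fin 2) ℝ) f) ∘ ofComplex)
      ((1 : ℝ) : ℂ) := by
  set h : ℍ → ℂ := SlashAction.map (2 * (k : ℤ)) (σ : GL (Fin 2) ℝ) (f : ℍ → ℂ) with hh
  set T := σ⁻¹ * γ * σ with hT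
  have hinv : SlashAction.map (2 * (k : ℤ)) (T : GL (Fin 2) ℝ) h = h := by
    rw [hh, ← SlashAction.slash_mul]
    have : (σ : GL (Fin 2) ℝ) * (T : GL (Fin 2) ℝ) = (γ : GL (Fin 2) ℝ) * (σ : GL (Fin 2) ℝ) := by
      rw [← map_mul, ← map_mul, hT]
      congr 1
      group
    rw [this, SlashAction.slash_mul,
      SlashInvariantFormClass.slash_action_eq f _ (toGL_mem_matrixLift hc.mem)]
  have hd := sl_det T
  rw [hc.lower, hc.diag] at hd
  have hd2 : T 1 1 ^ 2 = 1 := by linarith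
  have hd0 : T 1 1 ≠ 0 := by
    intro h0
    rw [h0] at hd2
    norm_num at hd2
  set e := T 0 1 * T 1 1 with he
  have he2 : e ^ 2 = 1 := by rw [he, mul_pow, hd2, hc.upper, one_mul]
  have hval : ∀ w : ℍ, h (T • w) = h w := by
    intro w
    have h1 := congrFun hinv w
    rw [ModularForm.slash_apply] at h1
    have h2 : denom (T : GL (Fin 2) ℝ) w = (T 1 1 : ℂ) := by
      have hl : T 1 0 = 0 := hc.lower
      simp [denom, hl]
    -- The weight is even, so the sign of the lift `T` has no effect.
    have h3 : ((T 1 1 : ℂ)) ^ (-(2 * (k : ℤ))) = 1 := by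
      rw [zpow_neg, zpow_mul]
      have : ((T 1 1 : ℂ)) ^ (2 : ℤ) = 1 := by exact_mod_cast hd2
      rw [this]
      simp
    rw [h2, h3] at h1
    have h4 : (T : GL (Fin 2) ℝ) • w = T • w := rfl
    simpa [UpperHalfPlane.σ, h4] using h1
  have hcoe : ∀ w : ℍ, ((T • w : ℍ) : ℂ) = w + e := by
    intro w
    have hdC : (T 1 1 : ℂ) ≠ 0 := by exact_mod_cast hd0
    have hd2C : (T 1 1 : ℂ) ^ 2 = 1 := by exact_mod_cast hd2
    rw [UpperHalfPlane.coe_specialLinearGroup_apply]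
    simp only [Algebra.algebraMap_self, RingHom.id_apply]
    rw [hc.lower, hc.diag, he]
    push_cast
    rw [zero_mul, zero_add, div_eq_iff hdC]
    linear_combination -(T 0 1 : ℂ) * hd2C
  have hpe : Function.Periodic (h ∘ ofComplex) (e : ℂ) := by
    intro w
    by_cases hw : 0 < w.im
    · have hw' : 0 < (w + e).im := by simpa using hw
      simp only [Function.comp_apply]
      rw [ofComplex_apply_of_im_pos hw, ofComplex_apply_of_im_pos hw', ← hval ⟨w, hw⟩]
      congr 1
      ext
      exact (hcoe ⟨w, hw⟩).symm
    · have hw1 : w.im ≤ 0 := not_lt.mp hw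
      have hw2 : (w + e).im ≤ 0 := by simpa using hw1
      simp [ofComplex_apply_of_im_nonpos hw1, ofComplex_apply_of_im_nonpos hw2]
  rcases mul_self_eq_one_iff.mp ((sq e).symm.trans he2) with h1 | h1
  · rwa [h1] at hpe
  · rw [h1] at hpe
    simpa using hpe.neg

/-- High in a cusp, the density is bounded by its values at height `y₀ ≥ k`. -/
theorem IsCuspChart.density_le {γ σ : SL(2, ℝ)} (hc : IsCuspChart Γ γ σ) (f : CuspForms Γ k)
    {y₀ B : ℝ} (hy₀ : 0 < y₀) (hk : k ≤ y₀)
    (hB : ∀ w : ℍ, w.im = y₀ → density k f (σ • w) ≤ B) {w : ℍ} (hw : y₀ ≤ w.im) :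
    density k f (σ • w) ≤ B := by
  rw [← density_slash]
  refine density_le_of_height (hc.periodic f) ((CuspFormClass.holo f).slash _ _)
    (CuspFormClass.zero_at_cusps f hc.isCusp _ rfl) hy₀ hk (fun v hv ↦ ?_) hw
  rw [density_slash]
  exact hB v hv

theorem isCompact_strip (a b : ℝ) (ha : 0 < a) :
    IsCompact {w : ℍ | 0 ≤ w.re ∧ w.re ≤ 1 ∧ a ≤ w.im ∧ w.im ≤ b} := by
  have hclosed : IsClosed {w : ℍ | 0 ≤ w.re ∧ w.re ≤ 1 ∧ a ≤ w.im ∧ w.im ≤ b} :=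
    (isClosed_le continuous_const continuous_re).inter
      ((isClosed_le continuous_re continuous_const).inter
        ((isClosed_le continuous_const continuous_im).inter
          (isClosed_le continuous_im continuous_const)))
  refine (isCompact_closedBall (⟨⟨0, a⟩, ha⟩ : ℍ) ((1 + b) / a)).of_isClosed_subset hclosed ?_
  rintro w ⟨h1, h2, h3, h4⟩
  rw [Metric.mem_closedBall]
  refine (dist_le_dist_coe_div_sqrt _ _).trans ?_
  have h5 : a ≤ √(w.im * a) := by
    apply Real.le_sqrt_of_sq_le
    nlinarith
  have h6 : dist (w : ℂ) ((⟨⟨0, a⟩, ha⟩ : ℍ) : ℂ) ≤ 1 + b := by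
    rw [Complex.dist_eq]
    refine (Complex.norm_le_abs_re_add_abs_im _).trans ?_
    simp only [Complex.sub_re, Complex.sub_im, coe_re, coe_im]
    change |w.re - 0| + |w.im - a| ≤ _
    rw [sub_zero, abs_of_nonneg h1, abs_of_nonneg (by linarith)]
    linarith
  calc _ ≤ (1 + b) / √(w.im * a) := by
        change _ / √(w.im * a) ≤ _
        gcongr
    _ ≤ _ := by
        apply div_le_div_of_nonneg_left _ ha h5
        linarith

/-- Below height `y₀` periodicity reduces to a compact strip; above it the maximum principle takes
over. -/
theorem IsCuspChart.exists_bound {γ σ : SL(2, ℝ)} (hc : IsCuspChart Γ γ σ) (f : CuspForms Γ k)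
    {a : ℝ} (ha : 0 < a) : ∃ B, ∀ w : ℍ, a ≤ w.im → density k f (σ • w) ≤ B := by
  set y₀ := max (k : ℝ) a with hy₀
  have hy₀pos : 0 < y₀ := lt_max_of_lt_right ha
  have hcont : Continuous fun w : ℍ ↦ density k f (σ • w) :=
    (continuous_density (CuspFormClass.holo f).continuous).comp (continuous_const_smul σ)
  obtain ⟨B, hB⟩ := (isCompact_strip a y₀ ha).bddAbove_image hcont.continuousOn
  have hlow : ∀ w : ℍ, a ≤ w.im → w.im ≤ y₀ → density k f (σ • w) ≤ B := by
    intro w h1 h2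
    set h : ℍ → ℂ := SlashAction.map (2 * (k : ℤ)) (σ : GL (Fin 2) ℝ) (f : ℍ → ℂ) with hh
    set n : ℤ := ⌊w.re⌋ with hn
    set v : ℍ := (-(n : ℝ)) +ᵥ w with hv
    have hvim : v.im = w.im := by simp [hv]
    have hvre : v.re = w.re - n := by
      simp [hv]
      ring
    have hhv : h v = h w := by
      have hp := (hc.periodic f).sub_int_mul_eq (x := (w : ℂ)) n
      have e : (v : ℂ) = (w : ℂ) - n * ((1 : ℝ) : ℂ) := by
        simp [hv]
        ring
      rw [← e] at hp
      simpa using hp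
    have e : density k f (σ • w) = density k f (σ • v) := by
      rw [← density_slash, ← density_slash, density, density, ← hh, hhv, hvim]
    rw [e]
    refine hB ⟨v, ⟨?_, ?_, hvim ▸ h1, hvim ▸ h2⟩, rfl⟩
    · rw [hvre]
      linarith [Int.floor_le w.re]
    · rw [hvre]
      linarith [Int.lt_floor_add_one w.re]
  refine ⟨B, fun w hw ↦ ?_⟩
  rcases le_total w.im y₀ with h | h
  · exact hlow w hw h
  · exact hc.density_le f hy₀pos (le_max_left _ _)
      (fun v hv ↦ hlow v (hv ▸ le_max_right _ _) hv.le) h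

/-- Every point is, modulo `Γ`, in a fixed compact set or in one of finitely many cusp
neighbourhoods. -/
theorem exists_cusp_decomposition (hΓ : IsCofiniteFuchsian Γ) :
    ∃ (K : Set ℍ) (S : Set (SL(2, ℝ) × SL(2, ℝ))), IsCompact K ∧ S.Finite ∧ ∀ z : ℍ,
      (∃ δ : Γ, δ • z ∈ K) ∨ ∃ δ : Γ, ∃ p ∈ S, IsCuspChart Γ p.1 p.2 ∧
        ∃ w : ℍ, δ • z = p.2 • w ∧ 64 ≤ w.im ∧ IsShortest (slLift Γ) p.1 (p.2 • w) := by
  have := discreteTopology_slLift hΓ.discrete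
  have : Countable Γ := countable_of_discrete
  obtain ⟨F, hF, hvol⟩ := hΓ.finite_area
  -- In a cusp chart `tnorm` is `1 / w.im ^ 2`, so the threshold `1/4096 = 1/64 ^ 2` means height
  -- above `64`.
  obtain ⟨K, P, hK, hP, hpar, hdec⟩ := exists_compact_and_parabolics (G := slLift Γ)
    (fun c hc ↦ exists_compact_of_thick hF hvol hc) (c := 1 / 4096) (by norm_num)
  have hσ : ∀ g : SL(2, ℝ), ∃ σ : SL(2, ℝ), g ≠ 1 → g ≠ -1 → (g 0 0 + g 1 1) ^ 2 = 4 →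
      (σ⁻¹ * g * σ) 1 0 = 0 ∧ (σ⁻¹ * g * σ) 0 0 = (σ⁻¹ * g * σ) 1 1 ∧
      ((σ⁻¹ * g * σ) 0 1) ^ 2 = 1 := by
    intro g
    by_cases h : g ≠ 1 ∧ g ≠ -1 ∧ (g 0 0 + g 1 1) ^ 2 = 4
    · obtain ⟨σ, hσ⟩ := exists_parabolic_conj h.1 h.2.1 h.2.2
      exact ⟨σ, fun _ _ _ ↦ hσ⟩
    · exact ⟨1, fun h1 h2 h3 ↦ absurd ⟨h1, h2, h3⟩ h⟩
  choose σ hσ using hσ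
  refine ⟨K, (fun g ↦ (g, σ g)) '' P, hK, hP.image _, fun z ↦ ?_⟩
  rcases hdec z with ⟨h, hh, hz⟩ | ⟨h, hh, g, hg, hs, hlt⟩
  · obtain ⟨δ, hδ⟩ := exists_smul_eq hh
    exact Or.inl ⟨δ, by rwa [hδ]⟩
  · obtain ⟨δ, hδ⟩ := exists_smul_eq hh
    obtain ⟨h1, h2, h3⟩ := hσ g hs.ne_one hs.ne_neg_one (hpar g hg)
    have hc : IsCuspChart Γ g (σ g) := ⟨hs.mem, h1, h2, h3⟩
    have hw : h • z = σ g • ((σ g)⁻¹ • h • z) := (smul_inv_smul _ _).symm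
    refine Or.inr ⟨δ, _, ⟨g, hg, rfl⟩, hc, (σ g)⁻¹ • h • z, by rw [hδ, ← hw], ?_, by rwa [← hw]⟩
    rw [hw, hc.tnorm] at hlt
    have hpos := ((σ g)⁻¹ • h • z).im_pos
    rw [div_lt_div_iff₀ (by positivity) (by norm_num)] at hlt
    nlinarith

/-- A qualitative bound depending on `f`. With finite area it makes the Petersson integrals
converge. -/
theorem exists_density_bound (hΓ : IsCofiniteFuchsian Γ) (f : CuspForms Γ k) :
    ∃ B, ∀ z, density k f z ≤ B := by
  obtain ⟨K, S, hK, hS, hdec⟩ := exists_cusp_decomposition hΓ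
  obtain ⟨B₁, hB₁⟩ := hK.bddAbove_image
    (continuous_density (k := k) (CuspFormClass.holo f).continuous).continuousOn
  have h : ∀ p : SL(2, ℝ) × SL(2, ℝ), ∃ B, IsCuspChart Γ p.1 p.2 →
      ∀ w : ℍ, 64 ≤ w.im → density k f (p.2 • w) ≤ B := by
    intro p
    by_cases hp : IsCuspChart Γ p.1 p.2
    · obtain ⟨B, hB⟩ := hp.exists_bound f (a := 64) (by norm_num)
      exact ⟨B, fun _ ↦ hB⟩
    · exact ⟨0, fun h ↦ absurd h hp⟩
  choose B hB using h
  obtain ⟨B₂, hB₂⟩ := (hS.image B).bddAbove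
  refine ⟨max B₁ B₂, fun z ↦ ?_⟩
  rcases hdec z with ⟨δ, hδ⟩ | ⟨δ, p, hp, hc, w, hw, him, -⟩
  · rw [← density_smul f δ]
    exact le_max_of_le_left (hB₁ ⟨_, hδ, rfl⟩)
  · rw [← density_smul f δ, hw]
    exact le_max_of_le_right ((hB p hc w him).trans (hB₂ ⟨p, hp, rfl⟩))

theorem volume_lt_top (hΓ : IsCofiniteFuchsian Γ) {F : Set ℍ}
    (hF : IsFundamentalDomain Γ F (volume : Measure ℍ)) : volume F < ⊤ := by
  have := discreteTopology_slLift hΓ.discrete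
  have : Countable Γ := countable_of_discrete
  obtain ⟨F₀, hF₀, hvol⟩ := hΓ.finite_area
  rwa [hF.measure_eq hF₀]

theorem integrableOn_density (hΓ : IsCofiniteFuchsian Γ) {F : Set ℍ}
    (hF : IsFundamentalDomain Γ F (volume : Measure ℍ)) (f : CuspForms Γ k) :
    IntegrableOn (density k f) F volume := by
  obtain ⟨B, hB⟩ := exists_density_bound hΓ f
  refine Measure.integrableOn_of_bounded (M := B) (volume_lt_top hΓ hF).ne
    (continuous_density (CuspFormClass.holo f).continuous).aestronglyMeasurable ?_
  refine Filter.Eventually.of_forall fun z ↦ ?_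
  rw [Real.norm_of_nonneg (density_nonneg k f z)]
  exact hB z

theorem density_le_mul_integral (hΓ : IsCofiniteFuchsian Γ) {F : Set ℍ}
    (hF : IsFundamentalDomain Γ F (volume : Measure ℍ)) (hk : 1 ≤ k) (f : CuspForms Γ k)
    {z : ℍ} {N : ℝ} (hN : DisplacementBound Γ z (1 / √k) N) :
    density k f z ≤ 25 * k * N * ∫ w in F, density k f w := by
  have := discreteTopology_slLift hΓ.discrete
  have : Countable Γ := countable_of_discrete
  have h := density_le_of_displacementBound hF hk f hN
  have hN0 := hN.nonneg
  have hI : 0 ≤ ∫ w in F, density k f w := integral_nonneg (density_nonneg k f)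
  rw [← ofReal_integral_eq_lintegral_ofReal (integrableOn_density hΓ hF f)
    (Filter.Eventually.of_forall (density_nonneg k f)), ← ENNReal.ofReal_mul (by positivity)] at h
  exact (ENNReal.ofReal_le_ofReal_iff (by positivity)).mp h

/-- The sup-norm bound for a single cusp form. -/
theorem exists_sup_bound (hΓ : IsCofiniteFuchsian Γ) :
    ∃ C : ℝ, 0 < C ∧ ∀ k : ℕ, 1 ≤ k → ∀ F : Set ℍ,
      IsFundamentalDomain Γ F (volume : Measure ℍ) → ∀ (f : CuspForms Γ k) (z : ℍ),
        density k f z ≤ C * (k : ℝ) ^ (3 / 2 : ℝ) * ∫ w in F, density k f w := by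
  have := discreteTopology_slLift hΓ.discrete
  obtain ⟨K, S, hK, hS, hdec⟩ := exists_cusp_decomposition hΓ
  obtain ⟨M, hM⟩ := exists_displacementBound_of_compact (Γ := Γ) hK 1
  -- The first constant serves the compact part. In a cusp, up to height `y₀ ≤ 64 * k`, the count is
  -- at most `(4 * 64 + 2) * √k`, and `25 * 258 = 6450`.
  refine ⟨max (25 * M) 6450, lt_max_of_lt_right (by norm_num), fun k hk F hF f z ↦ ?_⟩
  have hk' : (1 : ℝ) ≤ k := by exact_mod_cast hk
  have hsk : 1 ≤ √(k : ℝ) := Real.one_le_sqrt.mpr hk'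
  have hsk2 : √(k : ℝ) * √k = k := Real.mul_self_sqrt (by positivity)
  have hpow : (k : ℝ) ^ (3 / 2 : ℝ) = k * √k := by
    rw [Real.sqrt_eq_rpow, ← Real.rpow_one_add' (by positivity) (by norm_num)]
    norm_num
  have hR : 1 / √(k : ℝ) ≤ 1 := by
    rw [div_le_one (by positivity)]
    exact hsk
  have hI : 0 ≤ ∫ w in F, density k f w := integral_nonneg (density_nonneg k f)
  rw [hpow]
  rcases hdec z with ⟨δ, hδ⟩ | ⟨δ, ⟨γ, σ⟩, -, hc, w, hw, him, hs⟩
  · have hN := hM _ hδ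
    rw [← density_smul f δ]
    have h1 := density_le_mul_integral hΓ hF hk f (z := δ • z) (N := M)
      fun s hs ↦ hN s fun γ hγ ↦ (hs γ hγ).trans hR
    refine h1.trans ?_
    refine mul_le_mul_of_nonneg_right ?_ hI
    have hM0 := hN.nonneg
    calc 25 * (k : ℝ) * M = 25 * M * (k * 1) := by ring
      _ ≤ max (25 * M) 6450 * (k * √k) := by
        gcongr
        exact le_max_left _ _
  · rw [← density_smul f δ, hw]
    set y₀ := max (k : ℝ) 64 with hy₀
    have hy₀k : y₀ ≤ 64 * k := max_le (by linarith) (by linarith)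
    have hlow : ∀ v : ℍ, 64 ≤ v.im → v.im ≤ y₀ → density k f (σ • v) ≤
        max (25 * M) 6450 * (k * √k) * ∫ w in F, density k f w := by
      intro v h1 h2
      -- `γ` is known to be shortest only at `σ • w`; this persists at every height `≥ 64`, as the
      -- horocycle comparison needs.
      have hv : IsShortest (slLift Γ) γ (σ • v) := by
        refine hs.of_tnorm_le ?_
        rw [hc.tnorm]
        apply one_div_le_one_div_of_le (by norm_num)
        nlinarith
      have hN := hv.displacementBound hc.lower hc.diag hc.upper h1 (by positivity) hR
      refine (density_le_mul_integral hΓ hF hk f hN).trans ?_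
      refine mul_le_mul_of_nonneg_right ?_ hI
      have h3 : v.im * (1 / √(k : ℝ)) ≤ 64 * √k := by
        rw [mul_one_div, div_le_iff₀ (by positivity)]
        calc v.im ≤ 64 * k := h2.trans hy₀k
          _ = _ := by rw [mul_assoc, hsk2]
      calc 25 * (k : ℝ) * (4 * v.im * (1 / √k) + 2)
          ≤ 25 * k * (4 * (64 * √k) + 2 * √k) := by
            refine mul_le_mul_of_nonneg_left ?_ (by positivity)
            linarith
        _ = 6450 * (k * √k) := by ring
        _ ≤ _ := by
          gcongr
          exact le_max_right _ _
    rcases le_total w.im y₀ with h | h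
    · exact hlow w him h
    · exact hc.density_le f (lt_max_of_lt_right (by norm_num)) (le_max_left _ _)
        (fun v hv ↦ hlow v (hv ▸ le_max_right _ _) hv.le) h

end

/-! ### The Petersson inner product, the extremal argument and finite dimension. -/

section

variable {Γ : Subgroup PSL(2, ℝ)} {k : ℕ} {F : Set ℍ}

theorem norm_mul_conj_le (a b : ℂ) (y : ℝ) (hy : 0 < y) (k : ℕ) :
    ‖a * (starRingEnd ℂ) b * ((y : ℂ) ^ (2 * k))‖ ≤
      ‖a‖ ^ 2 * y ^ (2 * k) + ‖b‖ ^ 2 * y ^ (2 * k) := by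
  rw [norm_mul, norm_mul, RCLike.norm_conj, norm_pow, Complex.norm_real, Real.norm_of_nonneg hy.le,
    ← add_mul]
  gcongr
  nlinarith [sq_nonneg (‖a‖ - ‖b‖), mul_nonneg (norm_nonneg a) (norm_nonneg b)]

theorem integrableOn_petersson (hΓ : IsCofiniteFuchsian Γ)
    (hF : IsFundamentalDomain Γ F (volume : Measure ℍ)) (f g : CuspForms Γ k) :
    IntegrableOn (fun z : ℍ ↦ f z * (starRingEnd ℂ) (g z) * ((z.im : ℂ) ^ (2 * k))) F volume := by
  have hf : Continuous f := (CuspFormClass.holo f).continuous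
  have hg : Continuous g := (CuspFormClass.holo g).continuous
  have hi := UpperHalfPlane.continuous_im
  have hc : Continuous fun z : ℍ ↦ f z * (starRingEnd ℂ) (g z) * ((z.im : ℂ) ^ (2 * k)) :=
    (hf.mul (Complex.continuous_conj.comp hg)).mul ((Complex.continuous_ofReal.comp hi).pow _)
  exact ((integrableOn_density hΓ hF f).add (integrableOn_density hΓ hF g)).mono'
    hc.aestronglyMeasurable (Filter.Eventually.of_forall fun z ↦ norm_mul_conj_le _ _ _ z.im_pos k)

theorem peterssonInner_self (F : Set ℍ) (f : CuspForms Γ k) :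
    peterssonInner F f f = ((∫ z in F, density k f z : ℝ) : ℂ) := by
  rw [peterssonInner, ← integral_complex_ofReal]
  congr 1
  ext z
  rw [Complex.mul_conj, Complex.normSq_eq_norm_sq, density]
  push_cast
  rfl

theorem peterssonInner_conj (F : Set ℍ) (f g : CuspForms Γ k) :
    (starRingEnd ℂ) (peterssonInner F f g) = peterssonInner F g f := by
  rw [peterssonInner, peterssonInner, ← integral_conj]
  congr 1
  ext z
  simp only [map_mul, map_pow, Complex.conj_conj, Complex.conj_ofReal]
  ring

theorem peterssonInner_add_right (hΓ : IsCofiniteFuchsian Γ)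
    (hF : IsFundamentalDomain Γ F (volume : Measure ℍ)) (f g h : CuspForms Γ k) :
    peterssonInner F f (g + h) = peterssonInner F f g + peterssonInner F f h := by
  rw [peterssonInner, peterssonInner, peterssonInner,
    ← integral_add (integrableOn_petersson hΓ hF f g) (integrableOn_petersson hΓ hF f h)]
  congr 1
  ext z
  rw [add_apply, map_add]
  ring

theorem peterssonInner_smul_right (F : Set ℍ) (f g : CuspForms Γ k) (c : ℂ) :
    peterssonInner F f (c • g) = (starRingEnd ℂ) c * peterssonInner F f g := by
  rw [peterssonInner, peterssonInner, ← integral_const_mul]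
  congr 1
  ext z
  rw [smul_apply, smul_eq_mul, map_mul]
  ring

/-- Definiteness is read off from the sup-norm bound: a form of norm zero vanishes at every point.
-/
theorem eq_zero_of_integral_density_eq_zero (hΓ : IsCofiniteFuchsian Γ) (hk : 1 ≤ k)
    (hF : IsFundamentalDomain Γ F (volume : Measure ℍ)) (f : CuspForms Γ k)
    (h : ∫ z in F, density k f z = 0) : f = 0 := by
  obtain ⟨C, -, hC⟩ := exists_sup_bound hΓ
  refine CuspForm.ext fun z ↦ ?_
  have h1 := hC k hk F hF f z
  rw [h, mul_zero] at h1
  have h2 : ‖f z‖ ^ 2 * z.im ^ (2 * k) = 0 := le_antisymm h1 (density_nonneg k f z)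
  rcases mul_eq_zero.mp h2 with h3 | h3
  · simpa using h3
  · exact absurd h3 (pow_pos z.im_pos _).ne'

/-- The Petersson inner product, with the argument order of Mathlib (conjugate-linear in the first
variable). -/
@[reducible] def peterssonCore (hΓ : IsCofiniteFuchsian Γ) (hk : 1 ≤ k)
    (hF : IsFundamentalDomain Γ F (volume : Measure ℍ)) :
    InnerProductSpace.Core ℂ (CuspForms Γ k) where
  inner f g := peterssonInner F g f
  conj_inner_symm f g := peterssonInner_conj F f g
  re_inner_nonneg f := by
    rw [peterssonInner_self]
    exact integral_nonneg (density_nonneg k f)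
  add_left f g h := peterssonInner_add_right hΓ hF h f g
  smul_left f g c := peterssonInner_smul_right F g f c
  definite f hf := by
    rw [peterssonInner_self] at hf
    exact eq_zero_of_integral_density_eq_zero hΓ hk hF f (by exact_mod_cast hf)

/-- An extremal argument: a sup-norm bound for single cusp forms bounds the sum over an arbitrary
orthonormal family. -/
theorem sumSq_le_of_density_le {ι : Type} [Fintype ι] [DecidableEq ι] (hΓ : IsCofiniteFuchsian Γ)
    (hk : 1 ≤ k) (hF : IsFundamentalDomain Γ F (volume : Measure ℍ)) {A : ℝ} (hA : 0 ≤ A)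
    (hbound : ∀ (f : CuspForms Γ k) (z : ℍ), density k f z ≤ A * ∫ w in F, density k f w)
    {e : ι → CuspForms Γ k} (he : IsPeterssonOrthonormal F e) (z : ℍ) : sumSq e z ≤ A := by
  let core := peterssonCore hΓ hk hF
  let : NormedAddCommGroup (CuspForms Γ k) := core.toNormedAddCommGroup
  let : InnerProductSpace ℂ (CuspForms Γ k) := InnerProductSpace.ofCore core.toCore
  have hon : Orthonormal ℂ e := by
    rw [orthonormal_iff_ite]
    intro i j
    change peterssonInner F (e j) (e i) = _
    rw [he j i]
    simp only [eq_comm]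
  set s : ℝ := ∑ j, ‖e j z‖ ^ 2 with hs
  have hs0 : 0 ≤ s := by positivity
  -- This is the reproducing kernel of the span at `z`: both `f z` and the squared norm of `f` equal
  -- `s`. The bound for `f` reads `s ^ 2 * y ^ (2k) ≤ A * s`, and one factor `s` cancels.
  set f : CuspForms Γ k := ∑ j, (starRingEnd ℂ) (e j z) • e j with hf
  have hfz : f z = s := by
    rw [hf, sum_apply, hs]
    push_cast
    refine Finset.sum_congr rfl fun j _ ↦ ?_
    change (starRingEnd ℂ) (e j z) * e j z = _
    rw [Complex.conj_mul']
  have hint : ∫ w in F, density k f w = s := by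
    have h1 : inner ℂ f f = ∑ j, (starRingEnd ℂ) ((starRingEnd ℂ) (e j z)) *
        (starRingEnd ℂ) (e j z) := hon.inner_sum _ _ Finset.univ
    have h2 : inner ℂ f f = ((∫ w in F, density k f w : ℝ) : ℂ) := peterssonInner_self F f
    rw [h2] at h1
    have h3 : ∑ j, (starRingEnd ℂ) ((starRingEnd ℂ) (e j z)) * (starRingEnd ℂ) (e j z)
        = (s : ℂ) := by
      rw [hs]
      push_cast
      refine Finset.sum_congr rfl fun j _ ↦ ?_
      rw [Complex.conj_conj, Complex.mul_conj']
    rw [h3] at h1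
    exact_mod_cast h1
  have h := hbound f z
  rw [hint, density, hfz, Complex.norm_real, Real.norm_of_nonneg hs0] at h
  have hsum : sumSq e z = s * z.im ^ (2 * k) := by rw [sumSq, hs, Finset.sum_mul]
  rw [hsum]
  rcases hs0.eq_or_lt with h0 | h0
  · rw [← h0, zero_mul]
    exact hA
  · refine le_of_mul_le_mul_left ?_ h0
    linarith

/-- An orthonormal family of cusp forms has at most `A * vol F` members. -/
theorem card_le_of_density_le {ι : Type} [Fintype ι] [DecidableEq ι] (hΓ : IsCofiniteFuchsian Γ)
    (hk : 1 ≤ k) (hF : IsFundamentalDomain Γ F (volume : Measure ℍ)) {A : ℝ} (hA : 0 ≤ A)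
    (hbound : ∀ (f : CuspForms Γ k) (z : ℍ), density k f z ≤ A * ∫ w in F, density k f w)
    {e : ι → CuspForms Γ k} (he : IsPeterssonOrthonormal F e) :
    (Fintype.card ι : ℝ) ≤ A * (volume F).toReal := by
  have h1 : ∀ j, ∫ z in F, density k (e j) z = 1 := by
    intro j
    have h := he j j
    rw [peterssonInner_self, if_pos rfl] at h
    exact_mod_cast h
  have hint := fun j ↦ integrableOn_density hΓ hF (e j)
  have h2 : ∫ z in F, sumSq e z = Fintype.card ι := by
    calc ∫ z in F, sumSq e z = ∑ j, ∫ z in F, density k (e j) z :=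
          integral_finsetSum _ fun j _ ↦ hint j
      _ = _ := by simp [h1]
  have hvol := volume_lt_top hΓ hF
  calc (Fintype.card ι : ℝ) = ∫ z in F, sumSq e z := h2.symm
    _ ≤ ∫ _ in F, A := by
        refine integral_mono (integrable_finsetSum _ fun j _ ↦ hint j)
          (integrableOn_const hvol.ne) fun z ↦ sumSq_le_of_density_le hΓ hk hF hA hbound he z
    _ = A * (volume F).toReal := by
        rw [setIntegral_const, smul_eq_mul, mul_comm]
        rfl

/-- The span of any finite independent set has an orthonormal basis of the same size, so `A * vol F`
bounds the rank. -/
theorem finite_of_density_le (hΓ : IsCofiniteFuchsian Γ)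
    (hk : 1 ≤ k) (hF : IsFundamentalDomain Γ F (volume : Measure ℍ)) {A : ℝ} (hA : 0 ≤ A)
    (hbound : ∀ (f : CuspForms Γ k) (z : ℍ), density k f z ≤ A * ∫ w in F, density k f w) :
    Module.Finite ℂ (CuspForms Γ k) := by
  let core := peterssonCore hΓ hk hF
  let : NormedAddCommGroup (CuspForms Γ k) := core.toNormedAddCommGroup
  let : InnerProductSpace ℂ (CuspForms Γ k) := InnerProductSpace.ofCore core.toCore
  rw [← Module.rank_lt_aleph0_iff]
  refine (rank_le (n := ⌊A * (volume F).toReal⌋₊) fun s hs ↦ ?_).trans_lt Cardinal.natCast_lt_aleph0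
  refine Nat.le_floor ?_
  let b := stdOrthonormalBasis ℂ (Submodule.span ℂ (s : Set (CuspForms Γ k)))
  have hcard : Module.finrank ℂ (Submodule.span ℂ (s : Set (CuspForms Γ k))) = s.card :=
    finrank_span_finset_eq_card hs
  have he : IsPeterssonOrthonormal F fun i ↦ (b i : CuspForms Γ k) := by
    intro i j
    have h := orthonormal_iff_ite.mp b.orthonormal j i
    rw [Submodule.coe_inner] at h
    refine Eq.trans h ?_
    simp only [eq_comm]
  have h := card_le_of_density_le hΓ hk hF hA hbound he
  rwa [Fintype.card_fin, hcard] at h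

theorem exists_orthonormal_basis (hΓ : IsCofiniteFuchsian Γ) (hk : 1 ≤ k)
    (hF : IsFundamentalDomain Γ F (volume : Measure ℍ)) [Module.Finite ℂ (CuspForms Γ k)] :
    ∃ f : Module.Basis (Fin (Module.finrank ℂ (CuspForms Γ k))) ℂ (CuspForms Γ k),
      IsPeterssonOrthonormal F f := by
  let core := peterssonCore hΓ hk hF
  let : NormedAddCommGroup (CuspForms Γ k) := core.toNormedAddCommGroup
  let : InnerProductSpace ℂ (CuspForms Γ k) := InnerProductSpace.ofCore core.toCore
  let b := stdOrthonormalBasis ℂ (CuspForms Γ k)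
  refine ⟨b.toBasis, fun i j ↦ ?_⟩
  have h := orthonormal_iff_ite.mp b.orthonormal j i
  rw [OrthonormalBasis.coe_toBasis]
  refine Eq.trans h ?_
  simp only [eq_comm]

end

end

end FuchsianCusp

theorem theorem5p2 (Γ : Subgroup PSL(2, ℝ)) (hΓ : FuchsianCusp.IsCofiniteFuchsian Γ) :
    ∃ C : ℝ, 0 < C ∧ ∀ k : ℕ, 1 ≤ k →
      ∀ F : Set ℍ, IsFundamentalDomain Γ F (volume : Measure ℍ) →
        (∃ f : Module.Basis (Fin (Module.finrank ℂ (FuchsianCusp.CuspForms Γ k))) ℂ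
            (FuchsianCusp.CuspForms Γ k), FuchsianCusp.IsPeterssonOrthonormal F f) ∧
        ∀ f : Module.Basis (Fin (Module.finrank ℂ (FuchsianCusp.CuspForms Γ k))) ℂ
            (FuchsianCusp.CuspForms Γ k), FuchsianCusp.IsPeterssonOrthonormal F f →
          ∀ z : ℍ, FuchsianCusp.sumSq f z ≤ C * (k : ℝ) ^ (3 / 2 : ℝ) := by
  obtain ⟨C, hC, hbound⟩ := FuchsianCusp.exists_sup_bound hΓ
  refine ⟨C, hC, fun k hk F hF ↦ ?_⟩
  have hA : 0 ≤ C * (k : ℝ) ^ (3 / 2 : ℝ) := by positivity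
  have := FuchsianCusp.finite_of_density_le hΓ hk hF hA (hbound k hk F hF)
  exact ⟨FuchsianCusp.exists_orthonormal_basis hΓ hk hF, fun f hf z ↦
    FuchsianCusp.sumSq_le_of_density_le hΓ hk hF hA (hbound k hk F hF) hf z⟩
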